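/- Let $d\ge 1$ and $N\ge 0$ be integers. Let $\mathbb S^2\simeq\mathbb{CP}^1$ be the unit sphere of $\mathbb R^3$. Equip $(\mathbb S^2)^d$ with the product geodesic distance $\mathrm{dist}(x,y)=\big(\sum_{j=1}^d\theta_j^2\big)^{1/2}$, where $\theta_j\in[0,\pi]$ is the angle between $x_j$ and $y_j$, and with the product of the area measures normalised so that each sphere has area $1$. Let $L$ be the exterior tensor product of the hyperplane bundles $\mathcal O(1)$ of the $d$ factors, with its standard Hermitian metric, and let $S_N$ be the orthogonal projector of $L^2((\mathbb S^2)^d,L^{\otimes N})$ onto the space of holomorphic sections of $L^{\otimes N}$. Then $S_N$ has a continuous integral kernel $S_N(x,y)$, and the following holds. 1. Let $D>0$ and let $U,V\subset(\mathbb S^2)^d$ be Borel sets with $\mathrm{dist}(U,V)=D$. Then $$\sup_{x\in U}\int_{V}|S_N(x,y)|\,dy\le\frac{4}{\sqrt{2\pi d}}\,4^d\exp\!\Big(-\frac{(N+1)D^2}{16}\Big),$$ and the norms of the operator $\mathbf 1_US_N\mathbf 1_V$ from $L^\infty$ to $L^\infty$, from $L^1$ to $L^1$ and from $L^2$ to $L^2$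 are all bounded by the same quantity. 2. If $d\ge 3$, $D\ge 10\sqrt{d/(N+1)}$ and $U,V\subset(\mathbb S^2)^d$ are Borel sets (for instance open sets) with $\mathrm{dist}(U,V)=D$, then $$\|\mathbf 1_US_N\mathbf 1_V\|_{L^2\to L^2}\le\exp\!\Big(-\frac{(N+1)D^2}{21}\Big).$$ (In the metric rescaled so that each sphere has area $1$, distances are divided by $2\sqrt\pi$, so 1. and 2. also hold, a fortiori, for that metric.) -/

import Mathlib

open MeasureTheory Metric Set
open scoped ENNReal ComplexConjugate

noncomputable section

namespace SzegoSpheres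

/-- The space `ℂ²` with its Hermitian norm. -/
abbrev C2 : Type := EuclideanSpace ℂ (Fin 2)

/-- The unit sphere `S³` of `ℂ²`. -/
abbrev S3 : Type := sphere (0 : C2) 1

/-- The round unit sphere `S²` of `ℝ³`. -/
abbrev S2 : Type := sphere (0 : EuclideanSpace ℝ (Fin 3)) 1

/-! ### Geometry of `(S²)^d` -/

/-- The geodesic (great circle) distance of the unit sphere. -/
def sphereDist (x y : S2) : ℝ :=
  InnerProductGeometry.angle (x : EuclideanSpace ℝ (Fin 3)) (y : EuclideanSpace ℝ (Fin 3))

/-- The geodesic distance of the Riemannian product `(S²)^d`. -/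
def prodDist {d : ℕ} (x y : Fin d → S2) : ℝ :=
  Real.sqrt (∑ j, sphereDist (x j) (y j) ^ 2)

/-- `dist(U, V) = D`: the number `D` is the infimum of the distances between a point of `U`
and a point of `V`. No real number is the distance to an empty set. -/
def AtDistance {d : ℕ} (U V : Set (Fin d → S2)) (D : ℝ) : Prop :=
  IsGLB (image2 prodDist U V) D

/-! ### The Hopf fibration `S³ → S² ≅ ℂP¹` -/

/-- The Hopf map `(a, b) ↦ (2 Re(a b̄), 2 Im(a b̄), |a|² - |b|²)`. It identifies `S²` with the
quotient of `S³` by the circle, that is with `ℂP¹`. -/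
def hopfAux (z : C2) : EuclideanSpace ℝ (Fin 3) :=
  !₂[2 * (z 0 * conj (z 1)).re, 2 * (z 0 * conj (z 1)).im, ‖z 0‖ ^ 2 - ‖z 1‖ ^ 2]

theorem norm_hopfAux (z : S3) : ‖hopfAux (z : C2)‖ = 1 := by
  have h : ‖(z : C2)‖ = 1 := by simp
  have h2 : ‖(z : C2) 0‖ ^ 2 + ‖(z : C2) 1‖ ^ 2 = 1 := by
    have := EuclideanSpace.norm_sq_eq (z : C2)
    rw [h, Fin.sum_univ_two] at this
    linarith
  have h3 : ‖hopfAux (z : C2)‖ ^ 2 = 1 := by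
    rw [EuclideanSpace.norm_sq_eq, Fin.sum_univ_three]
    simp only [hopfAux, Complex.sq_norm, Complex.normSq_apply] at h2 ⊢
    simp
    have e : _ ^ 2 = (1 : ℝ) ^ 2 := congrArg (fun t => t ^ 2) h2
    simp only [mul_pow, sq_abs]
    ring_nf at e ⊢
    linarith
  nlinarith [norm_nonneg (hopfAux (z : C2))]

/-- The Hopf map `S³ → S²`. -/
def hopf (z : S3) : S2 :=
  ⟨hopfAux z, by rw [mem_sphere_zero_iff_norm]; exact norm_hopfAux z⟩

/-- The projection `(S³)^d → (S²)^d`. -/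
def proj {d : ℕ} (z : Fin d → S3) : Fin d → S2 := fun j => hopf (z j)

theorem continuous_hopfAux : Continuous hopfAux := by
  unfold hopfAux
  refine (PiLp.continuous_toLp 2 _).comp (continuous_pi fun i => ?_)
  fin_cases i <;> simp <;> fun_prop

theorem continuous_proj {d : ℕ} : Continuous (proj : (Fin d → S3) → Fin d → S2) :=
  continuous_pi fun j =>
    (Continuous.subtype_mk (continuous_hopfAux.comp continuous_subtype_val) _).comp
      (continuous_apply j)

theorem measurable_proj {d : ℕ} : Measurable (proj : (Fin d → S3) → Fin d → S2) :=
  continuous_proj.measurable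

/-- Multiplication by a unit complex number, on `S³`. -/
def rotOne (t : Circle) (z : S3) : S3 :=
  ⟨(t : ℂ) • (z : C2), by
    rw [mem_sphere_zero_iff_norm, norm_smul, Circle.norm_coe, one_mul]
    simp⟩

/-- The action of the torus on `(S³)^d`, whose orbits are the fibres of `proj`. -/
def rot {d : ℕ} (t : Fin d → Circle) (z : Fin d → S3) : Fin d → S3 := fun j => rotOne (t j) (z j)

theorem hopfAux_smul (t : Circle) (z : C2) : hopfAux ((t : ℂ) • z) = hopfAux z := by
  have e : (t : ℂ) * z 0 * conj ((t : ℂ) * z 1) = z 0 * conj (z 1) := by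
    have := Complex.mul_conj (t : ℂ)
    rw [Circle.normSq_coe] at this
    rw [map_mul]
    calc _ = ((t : ℂ) * conj (t : ℂ)) * (z 0 * conj (z 1)) := by ring
      _ = _ := by rw [this]; simp
  simp only [hopfAux, PiLp.smul_apply, smul_eq_mul, e, norm_mul, Circle.norm_coe, one_mul]

theorem proj_rot {d : ℕ} (t : Fin d → Circle) (z : Fin d → S3) : proj (rot t z) = proj z := by
  funext j
  exact Subtype.ext (hopfAux_smul (t j) (z j))

/-! ### Measures -/

/-- The rotation invariant probability measure on `S³`. Its image under the Hopf map is the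
area measure of `S²`, normalised to total mass one. -/
def sigma : Measure S3 :=
  ((volume : Measure C2).toSphere univ)⁻¹ • (volume : Measure C2).toSphere

instance : IsProbabilityMeasure sigma := by
  refine ⟨?_⟩
  simp only [sigma, Measure.smul_apply, smul_eq_mul]
  refine ENNReal.inv_mul_cancel ?_ (measure_ne_top _ _)
  rw [Ne, Measure.measure_univ_eq_zero]
  exact Measure.toSphere_ne_zero _

/-- The product probability measure on `(S³)^d`; its image under `proj` is the volume of
`(S²)^d`, normalised to total mass one. -/
def bundleMeasure (d : ℕ) : Measure (Fin d → S3) := Measure.pi fun _ => sigma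

instance (d : ℕ) : IsProbabilityMeasure (bundleMeasure d) := by
  unfold bundleMeasure; infer_instance

theorem continuous_rotOne (t : Circle) : Continuous (rotOne t) :=
  Continuous.subtype_mk (continuous_subtype_val.const_smul (t : ℂ)) _

open scoped Pointwise in
theorem measurePreserving_rotOne (t : Circle) : MeasurePreserving (rotOne t) sigma sigma := by
  have hm : Measurable (rotOne t) := (continuous_rotOne t).measurable
  let L : C2 ≃ₗᵢ[ℝ] C2 :=
    { toFun := fun z => (t : ℂ) • z
      invFun := fun z => ((t⁻¹ : Circle) : ℂ) • z
      left_inv := fun z => by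
        change ((t⁻¹ : Circle) : ℂ) • ((t : ℂ) • z) = z
        simp [smul_smul]
      right_inv := fun z => by
        change (t : ℂ) • (((t⁻¹ : Circle) : ℂ) • z) = z
        simp [smul_smul]
      map_add' := fun x y => smul_add _ _ _
      map_smul' := fun r x => smul_comm _ _ _
      norm_map' := fun x => by
        change ‖(t : ℂ) • x‖ = ‖x‖
        rw [norm_smul, Circle.norm_coe, one_mul] }
  have key : MeasurePreserving (rotOne t) (volume : Measure C2).toSphere
      (volume : Measure C2).toSphere := by
    refine ⟨hm, Measure.ext fun s hs => ?_⟩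
    rw [Measure.map_apply hm hs, Measure.toSphere_apply' _ (hm hs), Measure.toSphere_apply' _ hs]
    congr 1
    have e : (Ioo (0 : ℝ) 1 • (Subtype.val '' (rotOne t ⁻¹' s)) : Set C2)
        = L ⁻¹' (Ioo (0 : ℝ) 1 • (Subtype.val '' s)) := by
      ext z
      simp only [Set.mem_smul, Set.mem_image, Set.mem_preimage]
      constructor
      · rintro ⟨r, hr, _, ⟨w, hw, rfl⟩, rfl⟩
        exact ⟨r, hr, _, ⟨rotOne t w, hw, rfl⟩, smul_comm _ _ _⟩
      · rintro ⟨r, hr, _, ⟨w, hw, rfl⟩, hz⟩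
        refine ⟨r, hr, _, ⟨rotOne t⁻¹ w, ?_, rfl⟩, ?_⟩
        · have : rotOne t (rotOne t⁻¹ w) = w := by
            apply Subtype.ext
            simp [rotOne, smul_smul]
          rwa [this]
        · have h2 : L.symm (r • (w : C2)) = z := by rw [hz]; simp
          rw [← h2]
          exact smul_comm r (((t⁻¹ : Circle) : ℂ)) (w : C2)
    rw [e]
    exact L.measurePreserving.measure_preimage_equiv (f := L.toMeasurableEquiv) _
  exact key.smul_measure _

theorem measurePreserving_rot {d : ℕ} (t : Fin d → Circle) :
    MeasurePreserving (rot t) (bundleMeasure d) (bundleMeasure d) :=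
  measurePreserving_pi (fun _ => sigma) (fun _ => sigma) fun j => measurePreserving_rotOne (t j)

/-! ### Sections of the line bundle

`L` is the exterior tensor product over the `d` factors of the hyperplane bundle `O(1)` of
`ℂP¹ ≅ S²`. A section of the `N`-th tensor power of `L` is a function on the circle bundles
`(S³)^d` which is equivariant of weight `N` in every factor, and the pointwise norm of the
section is the modulus of the function. -/

/-- The character of weight `(N, …, N)` of the torus. -/
def character {d : ℕ} (N : ℕ) (t : Fin d → Circle) : ℂ := ∏ j, (t j : ℂ) ^ N

/-- The Hilbert space of square integrable sections of the `N`-th power of `L`. -/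
def L2Sections (d N : ℕ) : Submodule ℂ (Lp ℂ 2 (bundleMeasure d)) where
  carrier := {f | ∀ t : Fin d → Circle,
    (fun z => f (rot t z)) =ᵐ[bundleMeasure d] fun z => character N t * f z}
  zero_mem' := by
    intro t
    have h0 := Lp.coeFn_zero ℂ 2 (bundleMeasure d)
    have h1 := (measurePreserving_rot t).quasiMeasurePreserving.ae h0
    filter_upwards [h0, h1] with z a b
    change (0 : Lp ℂ 2 (bundleMeasure d)) (rot t z) = _ * (0 : Lp ℂ 2 (bundleMeasure d)) z
    rw [a, b]
    simp
  add_mem' := by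
    intro f g hf hg t
    have h0 := Lp.coeFn_add f g
    have h1 := (measurePreserving_rot t).quasiMeasurePreserving.ae h0
    filter_upwards [h0, h1, hf t, hg t] with z a b c e
    simp only [a, b, Pi.add_apply] at *
    rw [c, e]; ring
  smul_mem' := by
    intro c f hf t
    have h0 := Lp.coeFn_smul c f
    have h1 := (measurePreserving_rot t).quasiMeasurePreserving.ae h0
    filter_upwards [h0, h1, hf t] with z a b e
    simp only [a, b, Pi.smul_apply, smul_eq_mul] at *
    rw [e]; ring

theorem isClosed_L2Sections (d N : ℕ) :
    IsClosed (L2Sections d N : Set (Lp ℂ 2 (bundleMeasure d))) := by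
  have e : (L2Sections d N : Set (Lp ℂ 2 (bundleMeasure d)))
      = ⋂ t : Fin d → Circle, {f | Lp.compMeasurePreserving (rot t) (measurePreserving_rot t) f
          = character N t • f} := by
    ext f
    simp only [Set.mem_iInter, Set.mem_ofPred_eq]
    refine forall_congr' fun t => ?_
    have h1 := Lp.coeFn_compMeasurePreserving f (measurePreserving_rot t)
    have h2 := Lp.coeFn_smul (character N t) f
    rw [Lp.ext_iff]
    constructor
    · intro h
      filter_upwards [h1, h2, h] with z a b c
      rw [a, b]; exact c
    · intro h
      filter_upwards [h1, h2, h] with z a b c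
      rw [a, b] at c; exact c
  rw [e]
  exact isClosed_iInter fun t => isClosed_eq
    (Lp.isometry_compMeasurePreserving (measurePreserving_rot t)).continuous
    (continuous_const_smul _)

instance (d N : ℕ) : CompleteSpace (L2Sections d N) :=
  (isClosed_L2Sections d N).completeSpace_coe

/-- The holomorphic sections of the `N`-th power of `L`, as holomorphic functions on
`(ℂ² \ {0})^d` which are homogeneous of degree `N` in every block of variables. -/
def IsHolomorphicSection (d N : ℕ) (F : (Fin d → C2) → ℂ) : Prop :=
  DifferentiableOn ℂ F {Z | ∀ j, Z j ≠ 0} ∧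
    ∀ c : Fin d → ℂ, (∀ j, c j ≠ 0) → ∀ Z : Fin d → C2, (∀ j, Z j ≠ 0) →
      F (fun j => c j • Z j) = (∏ j, c j ^ N) * F Z

/-- The space `H⁰` of holomorphic sections, inside the square integrable sections. -/
def H0 (d N : ℕ) : Submodule ℂ (L2Sections d N) where
  carrier := {f | ∃ F, IsHolomorphicSection d N F ∧
    (f : Lp ℂ 2 (bundleMeasure d)) =ᵐ[bundleMeasure d] fun z => F fun j => (z j : C2)}
  zero_mem' := by
    refine ⟨0, ⟨differentiableOn_const 0, by simp⟩, ?_⟩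
    exact Lp.coeFn_zero ℂ 2 (bundleMeasure d)
  add_mem' := by
    rintro f g ⟨F, ⟨hF, hF'⟩, hf⟩ ⟨G, ⟨hG, hG'⟩, hg⟩
    refine ⟨F + G, ⟨hF.add hG, fun c hc Z hZ => ?_⟩, ?_⟩
    · simp only [Pi.add_apply, hF' c hc Z hZ, hG' c hc Z hZ]; ring
    · filter_upwards [Lp.coeFn_add (f : Lp ℂ 2 (bundleMeasure d)) g, hf, hg] with z a b c
      rw [Submodule.coe_add, a, Pi.add_apply, b, c]
      rfl
  smul_mem' := by
    rintro c f ⟨F, ⟨hF, hF'⟩, hf⟩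
    refine ⟨c • F, ⟨hF.const_smul c, fun a ha Z hZ => ?_⟩, ?_⟩
    · simp only [Pi.smul_apply, smul_eq_mul, hF' a ha Z hZ]; ring
    · filter_upwards [Lp.coeFn_smul c (f : Lp ℂ 2 (bundleMeasure d)), hf] with z a b
      rw [Submodule.coe_smul, a, Pi.smul_apply, b]
      rfl

/-- The Szegő projector `S_N`: the orthogonal projector of the square integrable sections onto
the holomorphic ones (a finite dimensional, hence closed, space: the closure changes nothing). -/
def szego (d N : ℕ) : L2Sections d N →L[ℂ] L2Sections d N :=
  (H0 d N).topologicalClosure.starProjection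

/-- The integral kernel `S_N(x, y)` of the Szegő projector, a section of the exterior product of
the `N`-th power of `L` with its conjugate, thus a biequivariant function on `(S³)^d × (S³)^d`.
These conditions determine `K`; the modulus `‖K z w‖` depends only on `proj z` and `proj w`. -/
structure IsSzegoKernel (d N : ℕ) (K : (Fin d → S3) → (Fin d → S3) → ℂ) : Prop where
  continuous : Continuous fun p : (Fin d → S3) × (Fin d → S3) => K p.1 p.2
  equivariant : ∀ (s t : Fin d → Circle) (z w : Fin d → S3),
    K (rot s z) (rot t w) = character N s * conj (character N t) * K z w
  represents : ∀ f : L2Sections d N,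
    (szego d N f : Lp ℂ 2 (bundleMeasure d)) =ᵐ[bundleMeasure d]
      fun z => ∫ w, K z w * (f : Lp ℂ 2 (bundleMeasure d)) w ∂bundleMeasure d

/-! ### Cut-offs -/

/-- The section `1_U f`. -/
def cutoffFun {d N : ℕ} {U : Set (Fin d → S2)} (hU : MeasurableSet U) (f : L2Sections d N) :
    L2Sections d N :=
  ⟨((Lp.memLp (f : Lp ℂ 2 (bundleMeasure d))).indicator (measurable_proj hU)).toLp _, by
    intro t
    have h0 := ((Lp.memLp (f : Lp ℂ 2 (bundleMeasure d))).indicator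
      (measurable_proj hU)).coeFn_toLp
    have h1 := (measurePreserving_rot t).quasiMeasurePreserving.ae h0
    filter_upwards [h0, h1, f.2 t] with z a b c
    rw [a, b]
    by_cases hz : proj z ∈ U
    · have hz' : proj (rot t z) ∈ U := by rwa [proj_rot]
      rw [Set.indicator_of_mem (s := proj ⁻¹' U) hz, Set.indicator_of_mem (s := proj ⁻¹' U) hz', c]
    · have hz' : proj (rot t z) ∉ U := by rwa [proj_rot]
      rw [Set.indicator_of_notMem (s := proj ⁻¹' U) hz,
        Set.indicator_of_notMem (s := proj ⁻¹' U) hz', mul_zero]⟩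

theorem cutoffFun_ae {d N : ℕ} {U : Set (Fin d → S2)} (hU : MeasurableSet U)
    (f : L2Sections d N) :
    (cutoffFun hU f : Lp ℂ 2 (bundleMeasure d)) =ᵐ[bundleMeasure d]
      (proj ⁻¹' U).indicator (f : Lp ℂ 2 (bundleMeasure d)) :=
  ((Lp.memLp (f : Lp ℂ 2 (bundleMeasure d))).indicator (measurable_proj hU)).coeFn_toLp

theorem cutoffFun_add {d N : ℕ} {U : Set (Fin d → S2)} (hU : MeasurableSet U)
    (f g : L2Sections d N) : cutoffFun hU (f + g) = cutoffFun hU f + cutoffFun hU g := by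
  refine Subtype.ext (Lp.ext ?_)
  filter_upwards [cutoffFun_ae hU (f + g), cutoffFun_ae hU f, cutoffFun_ae hU g,
    Lp.coeFn_add (f : Lp ℂ 2 (bundleMeasure d)) g,
    Lp.coeFn_add (cutoffFun hU f : Lp ℂ 2 (bundleMeasure d)) (cutoffFun hU g)]
    with z a b c e h
  rw [a, Submodule.coe_add (cutoffFun hU f), h, Pi.add_apply, b, c]
  by_cases hz : z ∈ proj ⁻¹' U
  · simp only [Set.indicator_of_mem hz]
    rw [Submodule.coe_add, e, Pi.add_apply]
  · simp only [Set.indicator_of_notMem hz, add_zero]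

theorem cutoffFun_smul {d N : ℕ} {U : Set (Fin d → S2)} (hU : MeasurableSet U)
    (r : ℂ) (f : L2Sections d N) : cutoffFun hU (r • f) = r • cutoffFun hU f := by
  refine Subtype.ext (Lp.ext ?_)
  filter_upwards [cutoffFun_ae hU (r • f), cutoffFun_ae hU f,
    Lp.coeFn_smul r (f : Lp ℂ 2 (bundleMeasure d)),
    Lp.coeFn_smul r (cutoffFun hU f : Lp ℂ 2 (bundleMeasure d))] with z a b c e
  rw [a, Submodule.coe_smul r (cutoffFun hU f), e, Pi.smul_apply, b]
  by_cases hz : z ∈ proj ⁻¹' U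
  · simp only [Set.indicator_of_mem hz]
    rw [Submodule.coe_smul, c, Pi.smul_apply]
  · simp only [Set.indicator_of_notMem hz, smul_zero]

theorem norm_cutoffFun_le {d N : ℕ} {U : Set (Fin d → S2)} (hU : MeasurableSet U)
    (f : L2Sections d N) : ‖cutoffFun hU f‖ ≤ 1 * ‖f‖ := by
  rw [one_mul, Submodule.coe_norm, Submodule.coe_norm]
  refine Lp.norm_le_norm_of_ae_le ?_
  filter_upwards [cutoffFun_ae hU f] with z a
  rw [a]
  exact norm_indicator_le_norm_self _ _

/-- The bounded operator `1_U` of multiplication by the indicator function of `U`. -/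
def cutoff {d : ℕ} (N : ℕ) {U : Set (Fin d → S2)} (hU : MeasurableSet U) :
    L2Sections d N →L[ℂ] L2Sections d N :=
  LinearMap.mkContinuous
    { toFun := cutoffFun hU
      map_add' := cutoffFun_add hU
      map_smul' := cutoffFun_smul hU }
    1 (norm_cutoffFun_le hU)

/-- The operator `1_U S_N 1_V`. -/
def localizedSzego {d : ℕ} (N : ℕ) {U V : Set (Fin d → S2)} (hU : MeasurableSet U)
    (hV : MeasurableSet V) : L2Sections d N →L[ℂ] L2Sections d N :=
  (cutoff N hU).comp ((szego d N).comp (cutoff N hV))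

/-- `C` bounds the norm of `T` from `L^p` to `L^p`: one has `‖T f‖_p ≤ C ‖f‖_p` for every square
integrable section `f` (where `‖f‖_p` may be infinite). -/
def LpBound {d N : ℕ} (p : ℝ≥0∞) (T : L2Sections d N →L[ℂ] L2Sections d N) (C : ℝ) : Prop :=
  ∀ f : L2Sections d N,
    eLpNorm (T f : Lp ℂ 2 (bundleMeasure d)) p (bundleMeasure d) ≤
      ENNReal.ofReal C * eLpNorm (f : Lp ℂ 2 (bundleMeasure d)) p (bundleMeasure d)

end SzegoSpheres

end

noncomputable section

namespace SzegoSpheres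

/-! ### The uniform distribution of the coordinates on `S³` -/

/-! The kernel is explicit: K(z,w) = ∏ (N+1)⟨z_j,w_j⟩^N. It reproduces holomorphic sections
(`integral_kernel_mul`): unitary invariance moves the evaluation point of one sphere to a pole,
where the mean value property applies, and induction on d with Fubini handles the product. Being
Hermitian and holomorphic in z, it is then the kernel of the orthogonal projector
(`szego_eq_kernelOp`).

The integral of |K| is controlled by two facts. If w is uniform on S³, then |⟨z,w⟩|² is uniform on
(0,1] (`measurePreserving_norm_sq_herm`). If θ is the angle between the Hopf images, then |⟨z,w⟩|² =
cos²(θ/2) ≤ exp(-θ²/4) (`norm_sq_herm_le`). So the points at distance at least D from z lie in {∏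
t_j ≤ δ}, with t_j = |⟨z_j,w_j⟩|² and δ = exp(-D²/4), and with b = N/2+1 one has |K| ≤ 2^d ∏ b
t_j^(b-1).

For the probability density ∏ b t_j^(b-1) the variables -b log t_j are independent standard
exponentials, so the mass of {∏ t_j ≤ δ} is the Gamma, or Poisson, tail e^(-x) ∑_{k<d} x^k/k! with x
= bD²/4 (`lintegral_cube_tail`). Half of e^(-x) is spent on bounding the sum by (4/√(2πd))2^d with
Stirling's formula; the other half is the announced Gaussian decay.

By Hermitian symmetry the same estimate holds with U and V exchanged. Row bounds give L^∞, column
bounds give L¹, and Schur's test gives L². The second estimate follows from the first because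
(N+1)D² ≥ 100d lets part of the exponential absorb 4^d. -/

theorem lintegral_Ioi_mul_comp_sq (f : ℝ → ℝ≥0∞) :
    ∫⁻ r in Ioi (0 : ℝ), ENNReal.ofReal (2 * r) * f (r ^ 2) = ∫⁻ x in Ioi (0 : ℝ), f x := by
  have himg : (fun r : ℝ => r ^ 2) '' Ioi 0 = Ioi 0 := by
    ext x
    constructor
    · rintro ⟨r, hr, rfl⟩
      exact pow_pos (mem_Ioi.1 hr) 2
    · intro hx
      exact ⟨Real.sqrt x, Real.sqrt_pos.2 hx, Real.sq_sqrt (le_of_lt hx)⟩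
  have h := lintegral_image_eq_lintegral_abs_deriv_mul (s := Ioi (0 : ℝ)) (f := fun r : ℝ => r ^ 2)
    (f' := fun r => 2 * r) measurableSet_Ioi
    (fun r _ => by simpa using (hasDerivAt_pow 2 r).hasDerivWithinAt)
    (fun a ha b hb hab => by
      exact (pow_left_inj₀ (le_of_lt ha) (le_of_lt hb) two_ne_zero).1 hab) f
  rw [himg] at h
  rw [h]
  refine setLIntegral_congr_fun measurableSet_Ioi fun r hr => ?_
  have hr' : (0 : ℝ) < r := hr
  simp only [abs_of_pos (mul_pos two_pos hr')]

theorem lintegral_comp_norm_sq {f : ℝ → ℝ≥0∞} (hf : Measurable f) :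
    ∫⁻ z : ℂ, f (‖z‖ ^ 2) = ENNReal.ofReal Real.pi * ∫⁻ x in Ioi (0 : ℝ), f x := by
  rw [← Complex.lintegral_comp_polarCoord_symm, polarCoord_target]
  have h1 : ∀ p ∈ Ioi (0 : ℝ) ×ˢ Ioo (-Real.pi) Real.pi,
      ENNReal.ofReal p.1 • f (‖Complex.polarCoord.symm p‖ ^ 2)
        = ENNReal.ofReal p.1 * f (p.1 ^ 2) := by
    intro p hp
    rw [Complex.norm_polarCoord_symm, sq_abs, smul_eq_mul]
  have hm : Measurable fun r : ℝ => ENNReal.ofReal r * f (r ^ 2) :=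
    ENNReal.measurable_ofReal.mul (hf.comp (measurable_id.pow_const 2))
  rw [setLIntegral_congr_fun (measurableSet_Ioi.prod measurableSet_Ioo) h1,
    Measure.volume_eq_prod, ← Measure.prod_restrict,
    lintegral_prod (fun p : ℝ × ℝ => ENNReal.ofReal p.1 * f (p.1 ^ 2))
      (hm.comp measurable_fst).aemeasurable]
  simp only [lintegral_const, Measure.restrict_apply, MeasurableSet.univ, univ_inter,
    Real.volume_Ioo]
  rw [lintegral_mul_const _ hm, ← lintegral_Ioi_mul_comp_sq f]
  have h2 : ∀ r : ℝ, ENNReal.ofReal (2 * r) * f (r ^ 2)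
      = 2 * (ENNReal.ofReal r * f (r ^ 2)) := by
    intro r
    rw [ENNReal.ofReal_mul zero_le_two]
    simp [mul_assoc]
  simp only [h2]
  rw [lintegral_const_mul _ hm, show Real.pi - -Real.pi = Real.pi * 2 by ring,
    ENNReal.ofReal_mul Real.pi_pos.le, mul_comm, mul_assoc]
  simp

theorem lintegral_Ioi_exp_neg_mul {b : ℝ} (hb : 0 < b) (a : ℝ) :
    ∫⁻ x in Ioi a, ENNReal.ofReal (Real.exp (-(b * x))) = ENNReal.ofReal (Real.exp (-(b * a)) / b) := by
  have hi := integrableOn_exp_mul_Ioi (neg_lt_zero.2 hb) a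
  have h := integral_exp_mul_Ioi (neg_lt_zero.2 hb) a
  simp only [neg_mul] at hi h
  rw [← ofReal_integral_eq_lintegral_ofReal hi (Filter.Eventually.of_forall fun x => (Real.exp_pos _).le), h]
  congr 1
  field_simp

/-- If X and Y are independent standard exponentials, then X/(X+Y) is uniform on [0,1]. For fixed x
the condition reads y ≥ (r⁻¹-1)x, so the inner integral is exp(-x/r). -/
theorem lintegral_lintegral_exp_neg {r : ℝ} (hr : 0 < r) (hr1 : r ≤ 1) :
    ∫⁻ x in Ioi (0 : ℝ), ∫⁻ y in Ioi (0 : ℝ),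
      {p : ℝ × ℝ | p.1 ≤ r * (p.1 + p.2)}.indicator
        (fun p => ENNReal.ofReal (Real.exp (-(p.1 + p.2)))) (x, y) = ENNReal.ofReal r := by
  have h1 : ∀ x ∈ Ioi (0 : ℝ), ∫⁻ y in Ioi (0 : ℝ),
      {p : ℝ × ℝ | p.1 ≤ r * (p.1 + p.2)}.indicator
        (fun p => ENNReal.ofReal (Real.exp (-(p.1 + p.2)))) (x, y)
      = ENNReal.ofReal (Real.exp (-(r⁻¹ * x))) := by
    intro x hx
    have hx' : (0 : ℝ) < x := hx
    have hset : ∀ y, (x, y) ∈ {p : ℝ × ℝ | p.1 ≤ r * (p.1 + p.2)} ↔ y ∈ Ici ((r⁻¹ - 1) * x) := by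
      intro y
      simp only [mem_ofPred_eq, mem_Ici]
      rw [← inv_mul_le_iff₀ hr]
      constructor <;> intro h <;> linarith
    have hnn : 0 ≤ (r⁻¹ - 1) * x :=
      mul_nonneg (sub_nonneg.2 ((one_le_inv₀ hr).2 hr1)) hx'.le
    calc _ = ∫⁻ y in Ioi (0 : ℝ), (Ici ((r⁻¹ - 1) * x)).indicator
          (fun y => ENNReal.ofReal (Real.exp (-x)) * ENNReal.ofReal (Real.exp (-(1 * y)))) y := by
          refine lintegral_congr fun y => ?_
          by_cases hy : y ∈ Ici ((r⁻¹ - 1) * x)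
          · rw [indicator_of_mem ((hset y).2 hy), indicator_of_mem hy,
              ← ENNReal.ofReal_mul (Real.exp_pos _).le, ← Real.exp_add]
            congr 2
            simp only
            ring
          · rw [indicator_of_notMem (fun h => hy ((hset y).1 h)), indicator_of_notMem hy]
      _ = ∫⁻ y in Ioi ((r⁻¹ - 1) * x),
            ENNReal.ofReal (Real.exp (-x)) * ENNReal.ofReal (Real.exp (-(1 * y))) := by
          rw [setLIntegral_indicator measurableSet_Ici]
          refine setLIntegral_congr ?_
          have : (Ici ((r⁻¹ - 1) * x) : Set ℝ) =ᵐ[volume] Ioi ((r⁻¹ - 1) * x) :=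
            Ioi_ae_eq_Ici.symm
          refine (this.inter (Filter.EventuallyEq.refl _ _)).trans ?_
          rw [inter_eq_left.2 (Ioi_subset_Ioi hnn)]
          exact Filter.EventuallyEq.refl _ _
      _ = _ := by
          rw [lintegral_const_mul _ (by fun_prop), lintegral_Ioi_exp_neg_mul one_pos,
            ← ENNReal.ofReal_mul (Real.exp_pos _).le, div_one, ← Real.exp_add]
          congr 2
          ring
  rw [setLIntegral_congr_fun measurableSet_Ioi h1, lintegral_Ioi_exp_neg_mul (inv_pos.2 hr)]
  simp

/-- The two coordinates of `ℂ²`. -/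
def coordEquiv : C2 ≃L[ℝ] ℂ × ℂ :=
  (PiLp.continuousLinearEquiv 2 ℝ fun _ : Fin 2 => ℂ).trans (ContinuousLinearEquiv.finTwoArrow ℝ ℂ)

theorem coordEquiv_apply (x : C2) : coordEquiv x = (x 0, x 1) := rfl

theorem norm_sq_C2 (x : C2) : ‖x‖ ^ 2 = ‖x 0‖ ^ 2 + ‖x 1‖ ^ 2 := by
  rw [EuclideanSpace.norm_sq_eq, Fin.sum_univ_two]

/-- Gaussian measure of the cone `|x₀|² ≤ r |x|²`, up to normalisation. -/
theorem exists_lintegral_gaussian_cone :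
    ∃ k : ℝ≥0∞, k ≠ 0 ∧ k ≠ ∞ ∧ ∀ r : ℝ, 0 < r → r ≤ 1 →
      ∫⁻ x : C2, {x : C2 | ‖x 0‖ ^ 2 ≤ r * ‖x‖ ^ 2}.indicator
        (fun x => ENNReal.ofReal (Real.exp (-‖x‖ ^ 2))) x = k * ENNReal.ofReal r := by
  have hhaar : ((volume : Measure C2).map coordEquiv).IsAddHaarMeasure :=
    coordEquiv.isAddHaarMeasure_map _
  -- Uniqueness of Haar measure suffices: the factor c is never computed, since it cancels when
  -- `sigma` is normalised.
  obtain ⟨c, hc0, hct, hc⟩ : ∃ c : ℝ≥0∞, c ≠ 0 ∧ c ≠ ∞ ∧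
      (volume : Measure C2).map coordEquiv = c • ((volume : Measure ℂ).prod (volume : Measure ℂ)) :=
    ⟨_, ENNReal.coe_ne_zero.2 (Measure.addHaarScalarFactor_pos_of_isAddHaarMeasure _ _).ne',
      ENNReal.coe_ne_top, Measure.isAddLeftInvariant_eq_smul _ _⟩
  refine ⟨c * (ENNReal.ofReal Real.pi * ENNReal.ofReal Real.pi), by simp [hc0, Real.pi_pos],
    ENNReal.mul_ne_top hct (ENNReal.mul_ne_top ENNReal.ofReal_ne_top ENNReal.ofReal_ne_top),
    fun r hr hr1 => ?_⟩
  set g : ℝ × ℝ → ℝ≥0∞ := {p : ℝ × ℝ | p.1 ≤ r * (p.1 + p.2)}.indicator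
        (fun p => ENNReal.ofReal (Real.exp (-(p.1 + p.2)))) with hg
  have hgm : Measurable g := by
    refine Measurable.indicator (by fun_prop) ?_
    exact measurableSet_le (by fun_prop) (by fun_prop)
  have hgm' : Measurable fun p : ℂ × ℂ => g (‖p.1‖ ^ 2, ‖p.2‖ ^ 2) :=
    hgm.comp (by fun_prop)
  have e1 : ∀ x : C2, {x : C2 | ‖x 0‖ ^ 2 ≤ r * ‖x‖ ^ 2}.indicator
        (fun x => ENNReal.ofReal (Real.exp (-‖x‖ ^ 2))) x
        = g (‖(coordEquiv x).1‖ ^ 2, ‖(coordEquiv x).2‖ ^ 2) := by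
    intro x
    simp only [hg, indicator, mem_ofPred_eq, coordEquiv_apply, norm_sq_C2]
  simp only [e1]
  rw [← lintegral_map hgm' coordEquiv.continuous.measurable, hc, lintegral_smul_measure,
    lintegral_prod _ hgm'.aemeasurable]
  simp only
  have e2 : ∀ x : ℂ, ∫⁻ y : ℂ, g (‖x‖ ^ 2, ‖y‖ ^ 2)
      = (fun t : ℝ => ENNReal.ofReal Real.pi * ∫⁻ y in Ioi (0 : ℝ), g (t, y)) (‖x‖ ^ 2) := by
    intro x
    exact lintegral_comp_norm_sq (f := fun y => g (‖x‖ ^ 2, y)) (by fun_prop)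
  have hm2 : Measurable fun t : ℝ => ∫⁻ y in Ioi (0 : ℝ), g (t, y) :=
    hgm.lintegral_prod_right'
  simp only [e2]
  rw [lintegral_comp_norm_sq (f := fun t : ℝ => ENNReal.ofReal Real.pi * ∫⁻ y in Ioi (0 : ℝ), g (t, y))
      (by fun_prop), lintegral_const_mul _ hm2, hg, lintegral_lintegral_exp_neg hr hr1]
  simp only [smul_eq_mul, mul_assoc]

/-- Integration in polar coordinates over the cone A with base B. With a Gaussian radial function g
it transfers the computation in ℂ², where the coordinates separate, to the sphere. -/
theorem lintegral_cone_eq_toSphere {B : Set S3} (hB : MeasurableSet B) {g : ℝ → ℝ≥0∞}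
    (hg : Measurable g) {A : Set C2}
    (hAB : ∀ (w : S3) (t : ℝ), 0 < t → (t • (w : C2) ∈ A ↔ w ∈ B)) :
    ∫⁻ x : C2, A.indicator (fun x => g ‖x‖) x
      = (volume : Measure C2).toSphere B *
        ∫⁻ t, g t ∂(Measure.volumeIoiPow (Module.finrank ℝ C2 - 1)) := by
  set F : S3 × Ioi (0 : ℝ) → ℝ≥0∞ := fun p => B.indicator 1 p.1 * g p.2
  have hF : Measurable F := by
    refine Measurable.mul ?_ (hg.comp (measurable_subtype_coe.comp measurable_snd))
    exact (measurable_one.indicator hB).comp measurable_fst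
  calc ∫⁻ x : C2, A.indicator (fun x => g ‖x‖) x
      = ∫⁻ x in ({0}ᶜ : Set C2), A.indicator (fun x => g ‖x‖) x := by
        rw [restrict_compl_singleton]
    _ = ∫⁻ x : ({0}ᶜ : Set C2), A.indicator (fun x => g ‖x‖) (x : C2)
          ∂((volume : Measure C2).comap Subtype.val) :=
        (lintegral_subtype_comap (measurableSet_singleton _).compl _).symm
    _ = ∫⁻ x : ({0}ᶜ : Set C2), F (homeomorphUnitSphereProd C2 x)
          ∂((volume : Measure C2).comap Subtype.val) := by
        refine lintegral_congr fun x => ?_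
        have hx : (0 : ℝ) < ‖(x : C2)‖ := norm_pos_iff.2 x.2
        have h1 : ‖(x : C2)‖ • ((homeomorphUnitSphereProd C2 x).1 : C2) = x := by
          simp [smul_smul, hx.ne']
        have h2 := hAB (homeomorphUnitSphereProd C2 x).1 _ hx
        rw [h1] at h2
        simp only [F, indicator, h2, homeomorphUnitSphereProd_apply_snd_coe]
        by_cases h : (homeomorphUnitSphereProd C2 x).1 ∈ B
        · simp [h, h2.2 h]
        · simp [h, mt h2.1 h]
    _ = ∫⁻ p, F p ∂((volume : Measure C2).toSphere.prod
          (Measure.volumeIoiPow (Module.finrank ℝ C2 - 1))) :=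
        (volume : Measure C2).measurePreserving_homeomorphUnitSphereProd.lintegral_comp hF
    _ = _ := by
        rw [lintegral_prod_mul (f := B.indicator 1) (g := fun t : Ioi (0 : ℝ) => g t)
          (measurable_one.indicator hB).aemeasurable
          (hg.comp measurable_subtype_coe).aemeasurable, lintegral_indicator_one hB]

theorem measurable_norm_sq_coord : Measurable fun w : S3 => ‖(w : C2) 0‖ ^ 2 := by
  fun_prop

theorem norm_sq_coord_le_one (w : S3) : ‖(w : C2) 0‖ ^ 2 ≤ 1 := by
  have h := norm_sq_C2 (w : C2)
  rw [norm_eq_of_mem_sphere] at h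
  nlinarith [sq_nonneg ‖(w : C2) 1‖]

theorem sigma_norm_sq_coord_le {r : ℝ} (hr : 0 < r) (hr1 : r ≤ 1) :
    sigma {w : S3 | ‖(w : C2) 0‖ ^ 2 ≤ r} = ENNReal.ofReal r := by
  obtain ⟨k, hk0, hkt, hk⟩ := exists_lintegral_gaussian_cone
  have hB : ∀ r : ℝ, MeasurableSet {w : S3 | ‖(w : C2) 0‖ ^ 2 ≤ r} := fun r =>
    measurableSet_le measurable_norm_sq_coord measurable_const
  set c := ∫⁻ t, ENNReal.ofReal (Real.exp (-(t : ℝ) ^ 2))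
    ∂(Measure.volumeIoiPow (Module.finrank ℝ C2 - 1))
  -- Both constants c and k are unknown; the case r = 1, where the set is the whole sphere,
  -- eliminates them.
  have key : ∀ r : ℝ, 0 < r → r ≤ 1 →
      (volume : Measure C2).toSphere {w : S3 | ‖(w : C2) 0‖ ^ 2 ≤ r} * c
        = k * ENNReal.ofReal r := by
    intro r hr hr1
    rw [← hk r hr hr1]
    refine (lintegral_cone_eq_toSphere (hB r) (g := fun t => ENNReal.ofReal (Real.exp (-t ^ 2)))
      (by fun_prop) fun w t ht => ?_).symm
    simp only [mem_ofPred_eq, PiLp.smul_apply, norm_smul, Real.norm_of_nonneg ht.le,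
      norm_eq_of_mem_sphere, mul_pow, mul_one]
    rw [mul_comm r, mul_le_mul_iff_right₀ (pow_pos ht 2)]
  have h1 := key 1 one_pos le_rfl
  have hu : {w : S3 | ‖(w : C2) 0‖ ^ 2 ≤ 1} = univ := eq_univ_of_forall norm_sq_coord_le_one
  rw [hu, ENNReal.ofReal_one, mul_one] at h1
  have hc0 : c ≠ 0 := by
    intro h
    rw [h, mul_zero] at h1
    exact hk0 h1.symm
  have hT0 : (volume : Measure C2).toSphere univ ≠ 0 := by
    intro h
    rw [h, zero_mul] at h1
    exact hk0 h1.symm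
  have hct : c ≠ ∞ := by
    intro h
    rw [h, ENNReal.mul_top hT0] at h1
    exact hkt h1.symm
  have h2 := key r hr hr1
  rw [← h1, mul_right_comm] at h2
  rw [ENNReal.mul_left_inj hc0 hct] at h2
  rw [sigma, Measure.smul_apply, smul_eq_mul, h2, ← mul_assoc,
    ENNReal.inv_mul_cancel hT0 (measure_ne_top _ _), one_mul]

/-- The squared modulus of a coordinate of a random point of `S³` is uniformly distributed. -/
theorem measurePreserving_norm_sq_coord :
    MeasurePreserving (fun w : S3 => ‖(w : C2) 0‖ ^ 2) sigma (volume.restrict (Ioc 0 1)) := by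
  refine ⟨measurable_norm_sq_coord, ?_⟩
  have := Measure.isFiniteMeasure_map sigma fun w : S3 => ‖(w : C2) 0‖ ^ 2
  refine Measure.ext_of_Iic _ _ fun a => ?_
  rw [Measure.map_apply measurable_norm_sq_coord measurableSet_Iic,
    Measure.restrict_apply measurableSet_Iic]
  change sigma {w : S3 | ‖(w : C2) 0‖ ^ 2 ≤ a} = _
  rcases le_or_gt a 0 with ha | ha
  · have e : Iic a ∩ Ioc (0 : ℝ) 1 = ∅ := by
      ext x
      simp only [mem_inter_iff, mem_Iic, mem_Ioc, mem_empty_iff_false, iff_false]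
      intro h
      linarith [h.1, h.2.1]
    rw [e, measure_empty]
    -- The distribution function is known only for positive levels, so the level a ≤ 0 is squeezed
    -- by min ε 1.
    refine le_antisymm (ENNReal.le_of_forall_pos_le_add fun ε hε _ => ?_) zero_le
    have hm : (0 : ℝ) < min ε 1 := lt_min hε one_pos
    rw [zero_add]
    calc sigma {w : S3 | ‖(w : C2) 0‖ ^ 2 ≤ a}
        ≤ sigma {w : S3 | ‖(w : C2) 0‖ ^ 2 ≤ min (ε : ℝ) 1} :=
          measure_mono fun w hw => le_trans hw (ha.trans hm.le)
      _ = ENNReal.ofReal (min (ε : ℝ) 1) := sigma_norm_sq_coord_le hm (min_le_right _ _)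
      _ ≤ ENNReal.ofReal ε := ENNReal.ofReal_le_ofReal (min_le_left _ _)
      _ = ε := ENNReal.ofReal_coe_nnreal
  · rcases le_or_gt a 1 with ha1 | ha1
    · rw [sigma_norm_sq_coord_le ha ha1, Iic_inter_Ioc_of_le ha1, Real.volume_Ioc, sub_zero]
    · have hu : {w : S3 | ‖(w : C2) 0‖ ^ 2 ≤ a} = univ :=
        eq_univ_of_forall fun w => (norm_sq_coord_le_one w).trans ha1.le
      have e : Iic a ∩ Ioc (0 : ℝ) 1 = Ioc 0 1 :=
        inter_eq_right.2 fun x hx => hx.2.trans ha1.le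
      rw [hu, e, measure_univ]
      simp

/-! ### The reproducing property of the kernel -/

/-- The Hermitian product of `ℂ²`, linear in the first variable. -/
def herm (z w : C2) : ℂ := z 0 * conj (w 0) + z 1 * conj (w 1)

theorem conj_herm (z w : C2) : conj (herm z w) = herm w z := by
  simp only [herm, map_add, map_mul, Complex.conj_conj]
  ring

theorem herm_smul_left (c : ℂ) (z w : C2) : herm (c • z) w = c * herm z w := by
  simp only [herm, PiLp.smul_apply, smul_eq_mul]
  ring

theorem herm_smul_right (c : ℂ) (z w : C2) : herm z (c • w) = conj c * herm z w := by
  simp only [herm, PiLp.smul_apply, smul_eq_mul, map_mul]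
  ring

theorem ne_zero_of_S3 (z : S3) : (z : C2) ≠ 0 := ne_zero_of_mem_unit_sphere z

/-! ### Unitary invariance of the measure of S³ -/

/-- The map of the unit sphere induced by a linear isometry. -/
def sphereMap (L : C2 →ₗᵢ[ℂ] C2) (z : S3) : S3 :=
  ⟨L z, by rw [mem_sphere_zero_iff_norm, L.norm_map]; simp⟩

theorem continuous_sphereMap (L : C2 →ₗᵢ[ℂ] C2) : Continuous (sphereMap L) :=
  Continuous.subtype_mk (L.continuous.comp continuous_subtype_val) _

open scoped Pointwise in
theorem measurePreserving_sphereMap (L : C2 →ₗᵢ[ℂ] C2) :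
    MeasurePreserving (sphereMap L) sigma sigma := by
  have hm : Measurable (sphereMap L) := (continuous_sphereMap L).measurable
  let E : C2 ≃ₗᵢ[ℂ] C2 := L.toLinearIsometryEquiv rfl
  let E' : C2 ≃ₗᵢ[ℝ] C2 :=
    { E.toLinearEquiv.restrictScalars ℝ with norm_map' := E.norm_map }
  have key : MeasurePreserving (sphereMap L) (volume : Measure C2).toSphere
      (volume : Measure C2).toSphere := by
    refine ⟨hm, Measure.ext fun s hs => ?_⟩
    rw [Measure.map_apply hm hs, Measure.toSphere_apply' _ (hm hs), Measure.toSphere_apply' _ hs]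
    congr 1
    have e : (Ioo (0 : ℝ) 1 • (Subtype.val '' (sphereMap L ⁻¹' s)) : Set C2)
        = E' ⁻¹' (Ioo (0 : ℝ) 1 • (Subtype.val '' s)) := by
      ext z
      simp only [Set.mem_smul, Set.mem_image, Set.mem_preimage]
      constructor
      · rintro ⟨r, hr, _, ⟨w, hw, rfl⟩, rfl⟩
        exact ⟨r, hr, _, ⟨sphereMap L w, hw, rfl⟩, (E'.map_smul r (w : C2)).symm⟩
      · rintro ⟨r, hr, _, ⟨w, hw, rfl⟩, hz⟩
        have hw' : E' (E'.symm w) = w := E'.apply_symm_apply _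
        refine ⟨r, hr, _, ⟨⟨E'.symm w, by
          rw [mem_sphere_zero_iff_norm, E'.symm.norm_map]; simp⟩, ?_, rfl⟩, ?_⟩
        · have : sphereMap L ⟨E'.symm w, by
              rw [mem_sphere_zero_iff_norm, E'.symm.norm_map]; simp⟩ = w := Subtype.ext hw'
          rwa [this]
        · apply E'.injective
          rw [E'.map_smul, hw', hz]
    rw [e]
    exact E'.measurePreserving.measure_preimage_equiv (f := E'.toMeasurableEquiv) _
  exact key.smul_measure _

/-- The unitary map with matrix `(a₀, -b \bar a₁; a₁, b \bar a₀)`, where `|a| = |b| = 1`. -/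
def unitaryMap (a : S3) (b : Circle) : C2 →ₗᵢ[ℂ] C2 where
  toFun w := !₂[(a : C2) 0 * w 0 - b * conj ((a : C2) 1) * w 1,
    (a : C2) 1 * w 0 + b * conj ((a : C2) 0) * w 1]
  map_add' x y := by
    ext i
    fin_cases i <;> simp <;> ring
  map_smul' c x := by
    ext i
    fin_cases i <;> simp <;> ring
  norm_map' w := by
    have ha := norm_sq_C2 (a : C2)
    have hb : Complex.normSq b = 1 := Circle.normSq_coe b
    rw [norm_eq_of_mem_sphere, one_pow] at ha
    refine (sq_eq_sq₀ (norm_nonneg _) (norm_nonneg _)).1 ?_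
    rw [norm_sq_C2, norm_sq_C2 w]
    simp only [Complex.sq_norm] at ha ⊢
    apply Complex.ofReal_injective
    have ha' := congrArg (fun t : ℝ => (t : ℂ)) ha
    have hb' := congrArg (fun t : ℝ => (t : ℂ)) hb
    simp only [Complex.ofReal_add, Complex.normSq_eq_conj_mul_self, Complex.ofReal_one] at ha' hb' ⊢
    simp only [LinearMap.coe_mk, AddHom.coe_mk, Matrix.cons_val_zero, Matrix.cons_val_one, map_add,
      map_sub, map_mul, Complex.conj_conj]
    linear_combination (-conj (w 0) * w 0 - conj (w 1) * w 1 * conj (b : ℂ) * b) * ha' +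
      conj (w 1) * w 1 * hb'

theorem unitaryMap_apply (a : S3) (b : Circle) (w : C2) :
    unitaryMap a b w = !₂[(a : C2) 0 * w 0 - b * conj ((a : C2) 1) * w 1,
      (a : C2) 1 * w 0 + b * conj ((a : C2) 0) * w 1] := rfl

/-- The vector a is the image of the pole (1,0), and a unitary map preserves the Hermitian product.
-/
theorem herm_unitaryMap (a : S3) (b : Circle) (w : C2) :
    herm a (unitaryMap a b w) = conj (w 0) := by
  have ha := norm_sq_C2 (a : C2)
  rw [norm_eq_of_mem_sphere, one_pow] at ha
  simp only [Complex.sq_norm] at ha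
  have ha' := congrArg (fun t : ℝ => (t : ℂ)) ha
  simp only [Complex.ofReal_add, Complex.normSq_eq_conj_mul_self, Complex.ofReal_one] at ha'
  simp only [herm, unitaryMap_apply, PiLp.toLp_apply, Matrix.cons_val_zero, Matrix.cons_val_one,
    map_add, map_sub, map_mul, Complex.conj_conj]
  linear_combination (-conj (w 0)) * ha'

/-- The first vector of the standard basis. -/
def poleS3 : S3 := ⟨!₂[1, 0], by
  rw [mem_sphere_zero_iff_norm, EuclideanSpace.norm_eq]
  simp [Fin.sum_univ_two]⟩

theorem unitaryMap_poleS3 (a : S3) (b : Circle) : unitaryMap a b poleS3 = a := by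
  ext i
  fin_cases i <;> simp [unitaryMap_apply, poleS3]

theorem measurePreserving_norm_sq_herm (z : S3) :
    MeasurePreserving (fun w : S3 => ‖herm z w‖ ^ 2) sigma (volume.restrict (Ioc 0 1)) := by
  have h := measurePreserving_norm_sq_coord
  have hm : Measurable fun w : S3 => ‖herm z w‖ ^ 2 := by
    unfold herm
    fun_prop
  refine ⟨hm, ?_⟩
  rw [← (measurePreserving_sphereMap (unitaryMap z 1)).map_eq,
    Measure.map_map hm (continuous_sphereMap _).measurable, ← h.map_eq]
  congr 1
  ext w
  simp [sphereMap, herm_unitaryMap]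

theorem integral_norm_coord_pow (N : ℕ) :
    ∫ w : S3, (‖(w : C2) 0‖ ^ 2) ^ N ∂sigma = 1 / (N + 1) := by
  have h := measurePreserving_norm_sq_coord
  rw [← integral_map (φ := fun w : S3 => ‖(w : C2) 0‖ ^ 2) (f := fun t : ℝ => t ^ N)
    h.measurable.aemeasurable (by fun_prop), h.map_eq,
    ← intervalIntegral.integral_of_le zero_le_one, integral_pow]
  simp

theorem ae_coord_ne_zero : ∀ᵐ w : S3 ∂sigma, (w : C2) 0 ≠ 0 := by
  have h : ∀ᵐ t ∂(volume.restrict (Ioc (0 : ℝ) 1)), t ≠ 0 := by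
    filter_upwards [ae_restrict_mem measurableSet_Ioc] with t ht
    exact ht.1.ne'
  filter_upwards [measurePreserving_norm_sq_coord.quasiMeasurePreserving.ae h] with w hw h0
  rw [h0] at hw
  simp at hw

/-- This is the reproducing property at the pole. Rotating the second coordinate changes neither
`sigma` nor w₀, so G(w) may be replaced by its average over these rotations. By the mean value
property in the second variable this average is G(w₀,0) = w₀^N G(1,0), and |w₀|^(2N) has integral
1/(N+1). -/
theorem integral_conj_coord_pow_mul {N : ℕ} {G : C2 → ℂ} (hG : DifferentiableOn ℂ G {0}ᶜ)
    (hh : ∀ c : ℂ, c ≠ 0 → ∀ Z : C2, Z ≠ 0 → G (c • Z) = c ^ N * G Z) :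
    ∫ w : S3, conj ((w : C2) 0) ^ N * G w ∂sigma = (1 / (N + 1)) * G poleS3 := by
  have hGc : Continuous fun w : S3 => G w :=
    hG.continuousOn.comp_continuous continuous_subtype_val ne_zero_of_S3
  set e : ℝ → Circle := fun θ => Circle.exp θ
  set f : ℝ → S3 → ℂ := fun θ w =>
    conj ((w : C2) 0) ^ N * G (sphereMap (unitaryMap poleS3 (e θ)) w) with hf
  have hval : ∀ θ (w : S3), ((sphereMap (unitaryMap poleS3 (e θ)) w : S3) : C2)
      = !₂[(w : C2) 0, circleMap 0 1 θ * (w : C2) 1] := by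
    intro θ w
    ext i
    fin_cases i <;> simp [sphereMap, unitaryMap_apply, poleS3, e, circleMap]
  have hfc : Continuous fun p : ℝ × S3 => f p.1 p.2 := by
    refine Continuous.mul (by fun_prop) (hGc.comp ?_)
    refine Topology.IsInducing.subtypeVal.continuous_iff.2 ?_
    simp only [Function.comp_def, hval]
    refine (PiLp.continuous_toLp 2 _).comp (continuous_pi fun i => ?_)
    fin_cases i <;> simp <;> fun_prop
  obtain ⟨M, hM⟩ : ∃ M, ∀ w : S3, ‖G w‖ ≤ M := by
    obtain ⟨M, hM⟩ := (isCompact_range hGc).isBounded.exists_norm_le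
    exact ⟨M, fun w => hM _ ⟨w, rfl⟩⟩
  have hbound : ∀ p : ℝ × S3, ‖f p.1 p.2‖ ≤ M := by
    intro p
    have h1 : ‖(p.2 : C2) 0‖ ≤ 1 := by
      have := norm_sq_coord_le_one p.2
      exact (sq_le_one_iff₀ (norm_nonneg _)).1 this
    simp only [hf, norm_mul, norm_pow, RCLike.norm_conj]
    calc _ ≤ 1 * M := mul_le_mul (pow_le_one₀ (norm_nonneg _) h1) (hM _) (norm_nonneg _) zero_le_one
      _ = M := one_mul M
  have hconst : ∀ θ, ∫ w, f θ w ∂sigma = ∫ w : S3, conj ((w : C2) 0) ^ N * G w ∂sigma := by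
    intro θ
    have hmp := measurePreserving_sphereMap (unitaryMap poleS3 (e θ))
    have hc : Continuous fun w : S3 => conj ((w : C2) 0) ^ N * G w :=
      Continuous.mul (by fun_prop) hGc
    conv_rhs => rw [← hmp.map_eq]
    rw [integral_map hmp.measurable.aemeasurable hc.aestronglyMeasurable]
    refine integral_congr_ae (Filter.Eventually.of_forall fun w => ?_)
    simp only [hf]
    congr 3
    rw [hval]
    simp
  have hmean : ∀ w : S3, (w : C2) 0 ≠ 0 →
      ∫ θ in (0 : ℝ)..2 * Real.pi, f θ w
        = 2 * Real.pi * (((‖(w : C2) 0‖ ^ 2) ^ N : ℝ) * G poleS3) := by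
    intro w hw
    -- As w₀ ≠ 0, the line of all (w₀,v) avoids the origin, the only point where G may fail to be
    -- holomorphic.
    have hd : Differentiable ℂ fun v : ℂ => G !₂[(w : C2) 0, v] := by
      intro v
      have hne : !₂[(w : C2) 0, v] ≠ 0 := by
        intro h
        exact hw (by simpa using congrArg (fun x : C2 => x 0) h)
      have hopen : IsOpen ({0}ᶜ : Set C2) := isOpen_compl_singleton
      refine DifferentiableAt.comp (g := G) v
        ((hG _ hne).differentiableAt (hopen.mem_nhds hne)) ?_
      refine DifferentiableAt.comp v
        (PiLp.continuousLinearEquiv 2 ℂ fun _ : Fin 2 => ℂ).symm.differentiableAt ?_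
      rw [differentiableAt_pi]
      intro i
      fin_cases i <;> simp
    have hdc : DiffContOnCl ℂ (fun v : ℂ => G !₂[(w : C2) 0, v * (w : C2) 1]) (ball 0 |1|) :=
      (hd.comp (differentiable_id.mul_const _)).diffContOnCl
    have h1 := hdc.circleAverage
    rw [Real.circleAverage] at h1
    have h0 : G !₂[(w : C2) 0, 0 * (w : C2) 1] = (w : C2) 0 ^ N * G poleS3 := by
      rw [← hh _ hw _ (ne_zero_of_S3 _)]
      congr 1
      ext i
      fin_cases i <;> simp [poleS3]
    rw [h0, inv_smul_eq_iff₀ (by positivity)] at h1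
    simp only [hf, hval]
    rw [intervalIntegral.integral_const_mul, h1, Complex.real_smul]
    have h2 : conj ((w : C2) 0) ^ N * (w : C2) 0 ^ N = ((‖(w : C2) 0‖ ^ 2) ^ N : ℝ) := by
      rw [← mul_pow, ← Complex.normSq_eq_conj_mul_self, Complex.sq_norm]
      push_cast
      rfl
    rw [← h2]
    push_cast
    ring
  have hswap : ∫ θ in (0 : ℝ)..2 * Real.pi, ∫ w, f θ w ∂sigma
      = ∫ w, (∫ θ in (0 : ℝ)..2 * Real.pi, f θ w) ∂sigma := by
    simp only [intervalIntegral.integral_of_le Real.two_pi_pos.le]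
    exact integral_integral_swap (Integrable.of_bound (f := fun p : ℝ × S3 => f p.1 p.2) hfc.aestronglyMeasurable M
      (Filter.Eventually.of_forall hbound))
  have hR : ∫ w, (∫ θ in (0 : ℝ)..2 * Real.pi, f θ w) ∂sigma
      = 2 * Real.pi * ((1 / (N + 1)) * G poleS3) := by
    rw [integral_congr_ae (g := fun w : S3 =>
      2 * Real.pi * (((‖(w : C2) 0‖ ^ 2) ^ N : ℝ) * G poleS3))
      (ae_coord_ne_zero.mono fun w hw => hmean w hw), integral_const_mul, integral_mul_const,
      integral_complex_ofReal, integral_norm_coord_pow]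
    push_cast
    rfl
  simp only [hconst, intervalIntegral.integral_const, sub_zero] at hswap
  rw [hR, Complex.real_smul] at hswap
  have hpi : ((2 * Real.pi : ℝ) : ℂ) ≠ 0 := by exact_mod_cast Real.two_pi_pos.ne'
  refine mul_left_cancel₀ hpi (hswap.trans ?_)
  push_cast
  rfl

/-- The reproducing property of the Szegő kernel of a single sphere. -/
theorem integral_herm_pow_mul {N : ℕ} {F : C2 → ℂ} (hF : DifferentiableOn ℂ F {0}ᶜ)
    (hh : ∀ c : ℂ, c ≠ 0 → ∀ Z : C2, Z ≠ 0 → F (c • Z) = c ^ N * F Z) (z : S3) :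
    ∫ w : S3, ((N + 1) * herm z w ^ N) * F w ∂sigma = F z := by
  set L := unitaryMap z 1
  have hL : ∀ x : C2, x ≠ 0 → L x ≠ 0 := fun x hx h => hx (L.injective (by rw [h, map_zero]))
  have h := integral_conj_coord_pow_mul (N := N) (G := fun x => F (L x))
    (hF.comp (L.toContinuousLinearMap.differentiable.differentiableOn) fun x hx => hL x hx)
    (fun c hc Z hZ => by rw [L.map_smul, hh c hc _ (hL Z hZ)])
  have hFc : Continuous fun w : S3 => F w :=
    hF.continuousOn.comp_continuous continuous_subtype_val ne_zero_of_S3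
  have hc : Continuous fun w : S3 => ((N + 1) * herm z w ^ N) * F w := by
    unfold herm
    exact Continuous.mul (by fun_prop) hFc
  have hmp := measurePreserving_sphereMap L
  rw [← hmp.map_eq, integral_map hmp.measurable.aemeasurable hc.aestronglyMeasurable]
  simp only [sphereMap, L, herm_unitaryMap, mul_assoc]
  simp only [unitaryMap_poleS3, L] at h
  rw [integral_const_mul, h, ← mul_assoc, mul_one_div_cancel, one_mul]
  exact_mod_cast Nat.succ_ne_zero N

/-- The Szegő kernel, as a function of vectors. -/
def kernelAux {d : ℕ} (N : ℕ) (Z W : Fin d → C2) : ℂ := ∏ j, ((N + 1) * herm (Z j) (W j) ^ N)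

/-- The Szegő kernel. -/
def kernel {d : ℕ} (N : ℕ) (z w : Fin d → S3) : ℂ :=
  kernelAux N (fun j => (z j : C2)) fun j => (w j : C2)

theorem continuous_kernel {d : ℕ} (N : ℕ) :
    Continuous fun p : (Fin d → S3) × (Fin d → S3) => kernel N p.1 p.2 := by
  unfold kernel kernelAux herm
  fun_prop

theorem conj_kernel {d : ℕ} (N : ℕ) (z w : Fin d → S3) : conj (kernel N z w) = kernel N w z := by
  simp [kernel, kernelAux, conj_herm]

/-! ### Slices of holomorphic sections and induction on the number of factors -/

theorem IsHolomorphicSection.continuous {d N : ℕ} {F : (Fin d → C2) → ℂ}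
    (hF : IsHolomorphicSection d N F) : Continuous fun z : Fin d → S3 => F fun j => (z j : C2) :=
  hF.1.continuousOn.comp_continuous (by fun_prop) fun z j => ne_zero_of_S3 (z j)

theorem IsHolomorphicSection.cons {d N : ℕ} {F : (Fin (d + 1) → C2) → ℂ}
    (hF : IsHolomorphicSection (d + 1) N F) {Z₀ : C2} (hZ₀ : Z₀ ≠ 0) :
    IsHolomorphicSection d N fun Z => F (Fin.cons Z₀ Z) := by
  refine ⟨hF.1.comp (f := fun Z : Fin d → C2 => (Fin.cons Z₀ Z : Fin (d + 1) → C2))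
    (Differentiable.differentiableOn ?_) ?_, ?_⟩
  · rw [differentiable_pi]
    intro i
    refine Fin.cases ?_ (fun j => ?_) i
    · simp
    · simp only [Fin.cons_succ]
      fun_prop
  · intro Z hZ i
    refine Fin.cases ?_ (fun j => ?_) i
    · simpa using hZ₀
    · simpa using hZ j
  · intro c hc Z hZ
    -- Scaling the frozen block by 1 leaves only the homogeneity in the other blocks.
    have h := hF.2 (Fin.cons 1 c) (fun i => by refine Fin.cases ?_ (fun j => ?_) i <;> simp [hc])
      (Fin.cons Z₀ Z) (fun i => by refine Fin.cases ?_ (fun j => ?_) i <;> simp [hZ₀, hZ])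
    rw [Fin.prod_univ_succ] at h
    simp only [Fin.cons_zero, one_pow, one_mul, Fin.cons_succ] at h
    rw [← h]
    refine congrArg F (funext fun i => ?_)
    refine Fin.cases ?_ (fun j => ?_) i <;> simp

theorem IsHolomorphicSection.fst {d N : ℕ} {F : (Fin (d + 1) → C2) → ℂ}
    (hF : IsHolomorphicSection (d + 1) N F) {Z : Fin d → C2} (hZ : ∀ j, Z j ≠ 0) :
    DifferentiableOn ℂ (fun Z₀ => F (Fin.cons Z₀ Z)) {0}ᶜ ∧
      ∀ c : ℂ, c ≠ 0 → ∀ Z₀ : C2, Z₀ ≠ 0 →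
        F (Fin.cons (c • Z₀) Z) = c ^ N * F (Fin.cons Z₀ Z) := by
  refine ⟨hF.1.comp (f := fun Z₀ : C2 => (Fin.cons Z₀ Z : Fin (d + 1) → C2))
    (Differentiable.differentiableOn ?_) ?_, ?_⟩
  · rw [differentiable_pi]
    intro i
    refine Fin.cases ?_ (fun j => ?_) i
    · simp only [Fin.cons_zero]
      fun_prop
    · simp
  · intro Z₀ hZ₀ i
    refine Fin.cases ?_ (fun j => ?_) i
    · simpa using hZ₀
    · simpa using hZ j
  · intro c hc Z₀ hZ₀
    have h := hF.2 (Fin.cons c 1) (fun i => by refine Fin.cases ?_ (fun j => ?_) i <;> simp [hc])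
      (Fin.cons Z₀ Z) (fun i => by refine Fin.cases ?_ (fun j => ?_) i <;> simp [hZ₀, hZ])
    rw [Fin.prod_univ_succ] at h
    simp only [Fin.cons_zero, Fin.cons_succ, Pi.one_apply, one_pow, Finset.prod_const_one,
      mul_one] at h
    rw [← h]
    refine congrArg F (funext fun i => ?_)
    refine Fin.cases ?_ (fun j => ?_) i <;> simp

theorem measurePreserving_cons (d : ℕ) :
    MeasurePreserving (fun p : S3 × (Fin d → S3) => (Fin.cons p.1 p.2 : Fin (d + 1) → S3))
      (sigma.prod (bundleMeasure d)) (bundleMeasure (d + 1)) := by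
  have h := (measurePreserving_piFinSuccAbove (fun _ : Fin (d + 1) => sigma) 0).symm
  have e : (fun p : S3 × (Fin d → S3) => (Fin.cons p.1 p.2 : Fin (d + 1) → S3))
      = (MeasurableEquiv.piFinSuccAbove (fun _ => S3) 0).symm := by
    funext p
    exact (Fin.insertNth_zero' p.1 p.2).symm
  rw [e]
  exact h

theorem integral_bundleMeasure_succ {d : ℕ} {f : (Fin (d + 1) → S3) → ℂ} (hf : Continuous f) :
    ∫ w, f w ∂bundleMeasure (d + 1)
      = ∫ w₀, ∫ w, f (Fin.cons w₀ w) ∂bundleMeasure d ∂sigma := by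
  have h := measurePreserving_cons d
  have hc : Continuous fun p : S3 × (Fin d → S3) => (Fin.cons p.1 p.2 : Fin (d + 1) → S3) := by
    refine continuous_pi fun i => ?_
    refine Fin.cases ?_ (fun j => ?_) i <;> simp <;> fun_prop
  rw [← h.map_eq, integral_map h.measurable.aemeasurable hf.aestronglyMeasurable]
  exact integral_prod _ ((hf.comp hc).integrable_of_hasCompactSupport
    (HasCompactSupport.of_compactSpace _))

/-- The reproducing property of the Szegő kernel. -/
theorem integral_kernel_mul {d N : ℕ} {F : (Fin d → C2) → ℂ} (hF : IsHolomorphicSection d N F)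
    (z : Fin d → S3) :
    ∫ w, kernel N z w * F (fun j => (w j : C2)) ∂bundleMeasure d = F fun j => (z j : C2) := by
  induction d with
  | zero =>
    have h : ∀ w : Fin 0 → S3, kernel N z w * F (fun j => (w j : C2)) = F fun j => (z j : C2) := by
      intro w
      rw [Subsingleton.elim w z]
      simp [kernel, kernelAux]
    simp [h]
  | succ d ih =>
    have hc : Continuous fun w : Fin (d + 1) → S3 => kernel N z w * F fun j => (w j : C2) :=
      ((continuous_kernel N).comp (by fun_prop : Continuous fun w => (z, w))).mul hF.continuous
    rw [integral_bundleMeasure_succ hc]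
    have hcons : ∀ (w₀ : S3) (w : Fin d → S3),
        (fun j => ((Fin.cons w₀ w : Fin (d + 1) → S3) j : C2))
          = Fin.cons (w₀ : C2) fun j => (w j : C2) := by
      intro w₀ w
      funext i
      refine Fin.cases ?_ (fun j => ?_) i <;> simp
    have hk : ∀ (w₀ : S3) (w : Fin d → S3), kernel N z (Fin.cons w₀ w)
        = ((N + 1) * herm (z 0) w₀ ^ N) * kernel N (fun j => z j.succ) w := by
      intro w₀ w
      rw [kernel, kernelAux, Fin.prod_univ_succ]
      rfl
    simp only [hk, hcons, mul_assoc _ (kernel N _ _)]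
    -- The last d integrals reproduce the slice with first block w₀; the first integral is then the
    -- case of a single sphere.
    have h1 : ∀ w₀ : S3, ∫ w, kernel N (fun j => z j.succ) w *
        F (Fin.cons (w₀ : C2) fun j => (w j : C2)) ∂bundleMeasure d
        = F (Fin.cons (w₀ : C2) fun j => (z j.succ : C2)) := fun w₀ =>
      ih (hF.cons (ne_zero_of_S3 w₀)) fun j => z j.succ
    simp only [integral_const_mul, h1]
    obtain ⟨h2, h3⟩ := hF.fst (Z := fun j => (z j.succ : C2)) fun j => ne_zero_of_S3 _
    rw [integral_herm_pow_mul h2 h3 (z 0)]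
    congr 1
    funext i
    refine Fin.cases ?_ (fun j => ?_) i <;> simp

/-! ### The kernel represents the Szegő projector -/

theorem kernel_rot {d : ℕ} (N : ℕ) (s t : Fin d → Circle) (z w : Fin d → S3) :
    kernel N (rot s z) (rot t w) = character N s * conj (character N t) * kernel N z w := by
  simp only [kernel, kernelAux, character, map_prod, ← Finset.prod_mul_distrib]
  refine Finset.prod_congr rfl fun j _ => ?_
  simp only [rot, rotOne, herm_smul_left, herm_smul_right, map_pow]
  ring

theorem kernelAux_smul {d : ℕ} (N : ℕ) (c : Fin d → ℂ) (Z W : Fin d → C2) :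
    kernelAux N (fun j => c j • Z j) W = (∏ j, c j ^ N) * kernelAux N Z W := by
  simp only [kernelAux, ← Finset.prod_mul_distrib]
  refine Finset.prod_congr rfl fun j _ => ?_
  rw [herm_smul_left]
  ring

/-- The binomial expansion separates Z from W. An integral of the kernel in W is thus a polynomial
in Z, and its holomorphy needs no differentiation under the integral sign. -/
theorem kernelAux_eq_sum {d : ℕ} (N : ℕ) (Z W : Fin d → C2) :
    kernelAux N Z W = ∑ κ ∈ Fintype.piFinset fun _ : Fin d => Finset.range (N + 1),
      (∏ j, (Z j 0 ^ κ j * Z j 1 ^ (N - κ j))) *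
        ∏ j, ((N + 1) * (N.choose (κ j) : ℂ) *
          (conj (W j 0) ^ κ j * conj (W j 1) ^ (N - κ j))) := by
  simp only [kernelAux, herm, add_pow, Finset.mul_sum, ← Finset.prod_mul_distrib]
  rw [Finset.prod_univ_sum]
  refine Finset.sum_congr rfl fun κ _ => Finset.prod_congr rfl fun j _ => ?_
  ring

/-- The holomorphic section defined by the Szegő kernel. -/
def kernelSection {d : ℕ} (N : ℕ) (u : (Fin d → S3) → ℂ) (Z : Fin d → C2) : ℂ :=
  ∫ w, kernelAux N Z (fun j => (w j : C2)) * u w ∂bundleMeasure d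

theorem isHolomorphicSection_kernelSection {d N : ℕ} {u : (Fin d → S3) → ℂ}
    (hu : Integrable u (bundleMeasure d)) : IsHolomorphicSection d N (kernelSection N u) := by
  refine ⟨Differentiable.differentiableOn ?_, fun c _ Z _ => ?_⟩
  · have hi : ∀ κ : Fin d → ℕ, Integrable (fun w : Fin d → S3 =>
        (∏ j, ((N + 1) * (N.choose (κ j) : ℂ) *
          (conj ((w j : C2) 0) ^ κ j * conj ((w j : C2) 1) ^ (N - κ j)))) * u w)
        (bundleMeasure d) := by
      intro κ
      have hc : Continuous fun w : Fin d → S3 => ∏ j, ((N + 1) * (N.choose (κ j) : ℂ) *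
          (conj ((w j : C2) 0) ^ κ j * conj ((w j : C2) 1) ^ (N - κ j))) := by
        fun_prop
      obtain ⟨M, hM⟩ := (isCompact_range hc).isBounded.exists_norm_le
      exact hu.bdd_mul hc.aestronglyMeasurable
        (Filter.Eventually.of_forall fun w => hM _ ⟨w, rfl⟩)
    have e : kernelSection N u = fun Z => ∑ κ ∈ Fintype.piFinset
        fun _ : Fin d => Finset.range (N + 1), (∏ j, (Z j 0 ^ κ j * Z j 1 ^ (N - κ j))) *
          ∫ w : Fin d → S3, (∏ j, ((N + 1) * (N.choose (κ j) : ℂ) *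
          (conj ((w j : C2) 0) ^ κ j * conj ((w j : C2) 1) ^ (N - κ j)))) * u w
          ∂bundleMeasure d := by
      funext Z
      simp only [kernelSection, kernelAux_eq_sum, Finset.sum_mul, mul_assoc (∏ j, (Z j 0 ^ _ * _))]
      rw [integral_finsetSum _ fun κ _ => (hi κ).const_mul _]
      simp only [integral_const_mul]
    rw [e]
    refine Differentiable.fun_sum fun κ _ => Differentiable.mul_const ?_ _
    have h : ∀ s : Finset (Fin d), Differentiable ℂ fun Z : Fin d → C2 =>
        ∏ j ∈ s, (Z j 0 ^ κ j * Z j 1 ^ (N - κ j)) := by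
      intro s
      induction s using Finset.induction_on with
      | empty => simp
      | insert a s ha ih =>
        simp only [Finset.prod_insert ha]
        exact Differentiable.mul (by fun_prop) ih
    exact h _
  · simp only [kernelSection, kernelAux_smul, mul_assoc, integral_const_mul]

theorem integrable_L2Sections {d N : ℕ} (f : L2Sections d N) :
    Integrable (f : Lp ℂ 2 (bundleMeasure d)) (bundleMeasure d) :=
  (Lp.memLp (f : Lp ℂ 2 (bundleMeasure d))).integrable one_le_two

theorem memLp_kernelSection {d N : ℕ} {u : (Fin d → S3) → ℂ}
    (hu : Integrable u (bundleMeasure d)) :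
    MemLp (fun z : Fin d → S3 => kernelSection N u fun j => (z j : C2)) 2 (bundleMeasure d) :=
  have : IsFiniteMeasureOnCompacts (bundleMeasure d) := inferInstance
  (isHolomorphicSection_kernelSection hu).continuous.memLp_of_hasCompactSupport
    (HasCompactSupport.of_compactSpace _)

theorem kernelSection_rot {d N : ℕ} (u : (Fin d → S3) → ℂ) (t : Fin d → Circle)
    (z : Fin d → S3) :
    kernelSection N u (fun j => (rot t z j : C2))
      = character N t * kernelSection N u fun j => (z j : C2) := by
  have h := fun W => kernelAux_smul N (fun j => (t j : ℂ)) (fun j => (z j : C2)) W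
  simp only [kernelSection, rot, rotOne, h, mul_assoc, integral_const_mul, character]

/-- The integral operator with kernel the Szegő kernel, on square integrable sections. -/
def kernelOp {d N : ℕ} (f : L2Sections d N) : L2Sections d N :=
  ⟨(memLp_kernelSection (N := N) (integrable_L2Sections f)).toLp _, by
    intro t
    have h0 := (memLp_kernelSection (N := N) (integrable_L2Sections f)).coeFn_toLp
    have h1 := (measurePreserving_rot t).quasiMeasurePreserving.ae h0
    filter_upwards [h0, h1] with z a b
    rw [a, b, kernelSection_rot]⟩

theorem kernelOp_ae {d N : ℕ} (f : L2Sections d N) :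
    (kernelOp f : Lp ℂ 2 (bundleMeasure d)) =ᵐ[bundleMeasure d]
      fun z => ∫ w, kernel N z w * (f : Lp ℂ 2 (bundleMeasure d)) w ∂bundleMeasure d :=
  (memLp_kernelSection (N := N) (integrable_L2Sections f)).coeFn_toLp

theorem kernelOp_mem_H0 {d N : ℕ} (f : L2Sections d N) : kernelOp f ∈ H0 d N :=
  ⟨_, isHolomorphicSection_kernelSection (integrable_L2Sections f), kernelOp_ae f⟩

theorem inner_L2Sections {d N : ℕ} (f g : L2Sections d N) :
    inner ℂ f g = ∫ z, conj ((f : Lp ℂ 2 (bundleMeasure d)) z) *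
      (g : Lp ℂ 2 (bundleMeasure d)) z ∂bundleMeasure d := by
  rw [Submodule.coe_inner, L2.inner_def]
  refine integral_congr_ae (Filter.Eventually.of_forall fun z => ?_)
  simp [mul_comm]

/-- The kernel is Hermitian, so after Fubini the operator acts on g, which it reproduces. -/
theorem inner_kernelOp {d N : ℕ} {g : L2Sections d N} (hg : g ∈ H0 d N) (f : L2Sections d N) :
    inner ℂ g (kernelOp f) = inner ℂ g f := by
  obtain ⟨F, hF, hgF⟩ := hg
  set u : (Fin d → S3) → ℂ := ⇑(f : Lp ℂ 2 (bundleMeasure d))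
  have hu : Integrable u (bundleMeasure d) := integrable_L2Sections f
  set h : (Fin d → S3) → ℂ := fun z => F fun j => (z j : C2)
  have hh : Continuous h := hF.continuous
  have hint : Integrable (fun p : (Fin d → S3) × (Fin d → S3) =>
      conj (h p.1) * (kernel N p.1 p.2 * u p.2)) ((bundleMeasure d).prod (bundleMeasure d)) := by
    have hc : Continuous fun p : (Fin d → S3) × (Fin d → S3) => conj (h p.1) * kernel N p.1 p.2 :=
      (Complex.continuous_conj.comp (hh.comp continuous_fst)).mul (continuous_kernel N)
    obtain ⟨M, hM⟩ := (isCompact_range hc).isBounded.exists_norm_le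
    simp only [← mul_assoc]
    exact (hu.comp_snd (bundleMeasure d)).bdd_mul hc.aestronglyMeasurable
      (Filter.Eventually.of_forall fun w => hM _ ⟨w, rfl⟩)
  rw [inner_L2Sections, inner_L2Sections]
  calc ∫ z, conj ((g : Lp ℂ 2 (bundleMeasure d)) z) *
        (kernelOp f : Lp ℂ 2 (bundleMeasure d)) z ∂bundleMeasure d
      = ∫ z, ∫ w, conj (h z) * (kernel N z w * u w) ∂bundleMeasure d ∂bundleMeasure d := by
        refine integral_congr_ae ?_
        filter_upwards [hgF, kernelOp_ae f] with z a b
        rw [a, b, integral_const_mul]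
    _ = ∫ w, ∫ z, conj (h z) * (kernel N z w * u w) ∂bundleMeasure d ∂bundleMeasure d :=
        integral_integral_swap hint
    _ = ∫ w, conj ((g : Lp ℂ 2 (bundleMeasure d)) w) * u w ∂bundleMeasure d := by
        refine integral_congr_ae ?_
        filter_upwards [hgF] with w a
        have hw : h w = ∫ z, kernel N w z * h z ∂bundleMeasure d := (integral_kernel_mul hF w).symm
        rw [a, hw, ← integral_conj, ← integral_mul_const]
        refine integral_congr_ae (Filter.Eventually.of_forall fun z => ?_)
        simp only [h, map_mul, conj_kernel]
        ring

/-- The orthogonal projection of f is characterised by lying in the space and differing from f by a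
vector orthogonal to it. Passing to the closure of `H0` does not change the orthogonal complement.
-/
theorem szego_eq_kernelOp {d N : ℕ} (f : L2Sections d N) : szego d N f = kernelOp f := by
  refine (Submodule.eq_starProjection_of_mem_orthogonal
    ((H0 d N).le_topologicalClosure (kernelOp_mem_H0 f)) ?_)
  rw [Submodule.orthogonal_closure, Submodule.mem_orthogonal]
  intro g hg
  rw [inner_sub_right, inner_kernelOp hg, sub_self]

theorem isSzegoKernel_kernel (d N : ℕ) : IsSzegoKernel d N (kernel N) where
  continuous := continuous_kernel N
  equivariant := kernel_rot N
  represents f := by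
    rw [szego_eq_kernelOp]
    exact kernelOp_ae f

/-! ### The Hermitian product and the geodesic distance -/

/-- On unit vectors this says cos θ = 2|⟨z,w⟩|² - 1, that is |⟨z,w⟩|² = cos²(θ/2): the Hopf map
doubles angles. -/
theorem inner_hopfAux (z w : C2) :
    inner ℝ (hopfAux z) (hopfAux w) = 2 * ‖herm z w‖ ^ 2 - ‖z‖ ^ 2 * ‖w‖ ^ 2 := by
  rw [norm_sq_C2, norm_sq_C2 w, PiLp.inner_apply, Fin.sum_univ_three]
  simp only [hopfAux, herm, Complex.sq_norm, Complex.normSq_apply]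
  simp
  ring

/-- The function cos y · exp(y²/2) equals 1 at 0 and decreases, as its derivative has the sign of y
cos y - sin y, negative because y < tan y. -/
theorem cos_le_exp_neg_sq_div_two {x : ℝ} (hx : 0 ≤ x) (hx' : x ≤ Real.pi / 2) :
    Real.cos x ≤ Real.exp (-(x ^ 2 / 2)) := by
  have hd : ∀ y : ℝ, HasDerivAt (fun y => Real.cos y * Real.exp (y ^ 2 / 2))
      (-Real.sin y * Real.exp (y ^ 2 / 2) + Real.cos y * (Real.exp (y ^ 2 / 2) * y)) y := by
    intro y
    have h := ((hasDerivAt_pow 2 y).div_const 2).exp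
    refine (Real.hasDerivAt_cos y).mul (h.congr_deriv ?_)
    push_cast
    ring
  have hanti : AntitoneOn (fun y => Real.cos y * Real.exp (y ^ 2 / 2)) (Icc 0 (Real.pi / 2)) := by
    refine antitoneOn_of_deriv_nonpos (convex_Icc _ _)
      (continuous_iff_continuousAt.2 fun y => (hd y).continuousAt).continuousOn
      (fun y _ => (hd y).differentiableAt.differentiableWithinAt) fun y hy => ?_
    rw [interior_Icc] at hy
    rw [(hd y).deriv]
    have hc : 0 < Real.cos y := Real.cos_pos_of_mem_Ioo ⟨by linarith [hy.1, Real.pi_pos], hy.2⟩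
    have ht := Real.lt_tan hy.1 hy.2
    rw [Real.tan_eq_sin_div_cos, lt_div_iff₀ hc] at ht
    nlinarith [Real.exp_pos (y ^ 2 / 2)]
  have h := hanti (left_mem_Icc.2 (by positivity)) ⟨hx, hx'⟩ hx
  simp only [Real.cos_zero, ne_eq, OfNat.ofNat_ne_zero, not_false_eq_true, zero_pow, zero_div,
    Real.exp_zero, mul_one] at h
  rwa [Real.exp_neg, ← one_div, le_div_iff₀ (Real.exp_pos _)]

theorem norm_sq_herm_le (z w : S3) :
    ‖herm z w‖ ^ 2 ≤ Real.exp (-(sphereDist (hopf z) (hopf w) ^ 2 / 4)) := by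
  set θ := sphereDist (hopf z) (hopf w) with hθ
  have h0 : 0 ≤ θ := InnerProductGeometry.angle_nonneg _ _
  have hpi : θ ≤ Real.pi := InnerProductGeometry.angle_le_pi _ _
  have hcos : Real.cos θ = 2 * ‖herm z w‖ ^ 2 - 1 := by
    rw [hθ, sphereDist, InnerProductGeometry.cos_angle, norm_eq_of_mem_sphere,
      norm_eq_of_mem_sphere]
    change inner ℝ (hopfAux z) (hopfAux w) / _ = _
    rw [inner_hopfAux, norm_eq_of_mem_sphere, norm_eq_of_mem_sphere]
    norm_num
  have h1 : ‖herm z w‖ ^ 2 = Real.cos (θ / 2) ^ 2 := by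
    rw [Real.cos_sq, mul_div_cancel₀ _ two_ne_zero, hcos]
    ring
  have h2 : 0 ≤ Real.cos (θ / 2) :=
    Real.cos_nonneg_of_mem_Icc ⟨by linarith [Real.pi_pos], by linarith⟩
  rw [h1]
  calc Real.cos (θ / 2) ^ 2 ≤ Real.exp (-((θ / 2) ^ 2 / 2)) ^ 2 :=
        pow_le_pow_left₀ h2 (cos_le_exp_neg_sq_div_two (by linarith) (by linarith)) 2
    _ = _ := by
        rw [← Real.exp_nat_mul]
        congr 1
        push_cast
        ring

theorem prod_norm_sq_herm_le {d : ℕ} {D : ℝ} (hD : 0 ≤ D) {z w : Fin d → S3}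
    (h : D ≤ prodDist (proj z) (proj w)) :
    ∏ j, ‖herm (z j) (w j)‖ ^ 2 ≤ Real.exp (-(D ^ 2 / 4)) := by
  have h1 : D ^ 2 ≤ ∑ j, sphereDist (hopf (z j)) (hopf (w j)) ^ 2 :=
    (Real.le_sqrt hD (Finset.sum_nonneg fun j _ => sq_nonneg _)).1 h
  calc ∏ j, ‖herm (z j) (w j)‖ ^ 2
      ≤ ∏ j, Real.exp (-(sphereDist (hopf (z j)) (hopf (w j)) ^ 2 / 4)) :=
        Finset.prod_le_prod (fun j _ => sq_nonneg _) fun j _ => norm_sq_herm_le _ _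
    _ = Real.exp (-((∑ j, sphereDist (hopf (z j)) (hopf (w j)) ^ 2) / 4)) := by
        rw [← Real.exp_sum, Finset.sum_neg_distrib, Finset.sum_div]
    _ ≤ _ := Real.exp_le_exp.2 (by linarith)

/-! ### Tails of the Poisson distribution -/

/-- The maximum of x^k exp(-x/2) is at x = 2k, where it equals 2^k (k/e)^k; Stirling's lower bound
for k! does the rest. The inequality 1 + y ≤ e^y at y = x/(2k) - 1 replaces the study of the
maximum. -/
theorem pow_div_factorial_mul_exp_le {x : ℝ} (hx : 0 ≤ x) {k : ℕ} (hk : k ≠ 0) :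
    x ^ k / k.factorial * Real.exp (-(x / 2)) ≤ 2 ^ k / Real.sqrt (2 * Real.pi * k) := by
  have hk' : (0 : ℝ) < k := by exact_mod_cast Nat.pos_of_ne_zero hk
  have hst := Stirling.le_factorial_stirling k
  have hs : 0 < Real.sqrt (2 * Real.pi * k) := Real.sqrt_pos.2 (by positivity)
  have hf : (0 : ℝ) < k.factorial := by exact_mod_cast k.factorial_pos
  have h1 : x / (2 * k) ≤ Real.exp (x / (2 * k) - 1) := by
    have := Real.add_one_le_exp (x / (2 * k) - 1)
    linarith
  have h2 : (x / (2 * k)) ^ k ≤ Real.exp (x / 2) / Real.exp 1 ^ k := by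
    calc (x / (2 * k)) ^ k ≤ Real.exp (x / (2 * k) - 1) ^ k :=
          pow_le_pow_left₀ (by positivity) h1 k
      _ = _ := by
          rw [← Real.exp_nat_mul, ← Real.exp_nat_mul, ← Real.exp_sub]
          congr 1
          field_simp
  have h3 : x ^ k ≤ 2 ^ k * Real.exp (x / 2) * (k / Real.exp 1) ^ k := by
    rw [div_pow, mul_pow, div_le_iff₀ (by positivity)] at h2
    rw [div_pow]
    refine h2.trans (le_of_eq ?_)
    ring
  rw [Real.exp_neg, ← div_eq_mul_inv, div_div, div_le_div_iff₀ (by positivity) hs]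
  calc x ^ k * Real.sqrt (2 * Real.pi * k)
      ≤ 2 ^ k * Real.exp (x / 2) * (k / Real.exp 1) ^ k * Real.sqrt (2 * Real.pi * k) :=
        mul_le_mul_of_nonneg_right h3 hs.le
    _ = 2 ^ k * Real.exp (x / 2) * (Real.sqrt (2 * Real.pi * k) * (k / Real.exp 1) ^ k) := by ring
    _ ≤ 2 ^ k * Real.exp (x / 2) * k.factorial := mul_le_mul_of_nonneg_left hst (by positivity)
    _ = 2 ^ k * (k.factorial * Real.exp (x / 2)) := by ring

theorem sum_pow_div_factorial_mul_exp_le {x : ℝ} (hx : 0 ≤ x) {d : ℕ} (hd : 1 ≤ d) :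
    (∑ k ∈ Finset.range d, x ^ k / k.factorial) * Real.exp (-(x / 2))
      ≤ 4 / Real.sqrt (2 * Real.pi * d) * 2 ^ d := by
  induction d, hd using Nat.le_induction with
  | base =>
    have h1 : Real.exp (-(x / 2)) ≤ 1 := Real.exp_le_one_iff.2 (by linarith)
    have h2 : Real.sqrt (2 * Real.pi * (1 : ℕ)) ≤ 4 := by
      rw [Real.sqrt_le_left (by norm_num)]
      push_cast
      linarith [Real.pi_lt_four]
    have h3 : 1 ≤ 4 / Real.sqrt (2 * Real.pi * (1 : ℕ)) := by
      rw [one_le_div (Real.sqrt_pos.2 (by positivity))]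
      exact h2
    simp only [Finset.sum_range_one, pow_zero, Nat.factorial_zero, Nat.cast_one, div_one, one_mul,
      pow_one] at h3 ⊢
    linarith
  | succ d hd ih =>
    have hd' : (1 : ℝ) ≤ d := by exact_mod_cast hd
    have hs : 0 < Real.sqrt (2 * Real.pi * d) := Real.sqrt_pos.2 (by positivity)
    have hs' : 0 < Real.sqrt (2 * Real.pi * (d + 1 : ℕ)) := Real.sqrt_pos.2 (by positivity)
    -- The new term adds 1 to the coefficient 4, while the target doubles 2^d. The induction closes
    -- because 25(d+1) ≤ 64d for d ≥ 1.
    have hle : 5 * Real.sqrt (2 * Real.pi * (d + 1 : ℕ)) ≤ 8 * Real.sqrt (2 * Real.pi * d) := by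
      rw [← sq_le_sq₀ (by positivity) (by positivity), mul_pow, mul_pow,
        Real.sq_sqrt (by positivity), Real.sq_sqrt (by positivity)]
      push_cast
      nlinarith [Real.pi_pos]
    rw [Finset.sum_range_succ, add_mul]
    calc _ ≤ 4 / Real.sqrt (2 * Real.pi * d) * 2 ^ d + 2 ^ d / Real.sqrt (2 * Real.pi * d) :=
          add_le_add ih (pow_div_factorial_mul_exp_le hx (by omega))
      _ = 5 / Real.sqrt (2 * Real.pi * d) * 2 ^ d := by ring
      _ ≤ 8 / Real.sqrt (2 * Real.pi * (d + 1 : ℕ)) * 2 ^ d := by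
          refine mul_le_mul_of_nonneg_right ?_ (by positivity)
          rwa [div_le_div_iff₀ hs hs']
      _ = _ := by ring

/-! ### The measure of the set where the product of the coordinates is small -/

/-- Bound for the mass of the set of `t` with `∏ tⱼ ≤ δ`, for the density `∏ b tⱼ ^ (b - 1)`. -/
def tailBound (b : ℝ) (d : ℕ) (δ : ℝ) : ℝ :=
  if 1 ≤ δ then 1 else δ ^ b * ∑ k ∈ Finset.range d, (-(b * Real.log δ)) ^ k / k.factorial

theorem tailBound_of_one_le (b : ℝ) (d : ℕ) {δ : ℝ} (h : 1 ≤ δ) : tailBound b d δ = 1 := if_pos h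

theorem tailBound_of_lt_one (b : ℝ) (d : ℕ) {δ : ℝ} (h : δ < 1) : tailBound b d δ =
    δ ^ b * ∑ k ∈ Finset.range d, (-(b * Real.log δ)) ^ k / k.factorial := if_neg (not_le.2 h)

theorem lintegral_rpow_Ioc {b : ℝ} (hb : 0 < b) {δ : ℝ} (hδ : 0 ≤ δ) :
    ∫⁻ t in Ioc 0 δ, ENNReal.ofReal (b * t ^ (b - 1)) = ENNReal.ofReal (δ ^ b) := by
  have hi : IntervalIntegrable (fun t : ℝ => b * t ^ (b - 1)) volume 0 δ :=
    (intervalIntegral.intervalIntegrable_rpow' (by linarith)).const_mul b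
  rw [← ofReal_integral_eq_lintegral_ofReal, ← intervalIntegral.integral_of_le hδ,
    intervalIntegral.integral_const_mul, integral_rpow (Or.inl (by linarith))]
  · rw [sub_add_cancel, Real.zero_rpow hb.ne', sub_zero, mul_div_cancel₀ _ hb.ne']
  · exact (intervalIntegrable_iff_integrableOn_Ioc_of_le hδ).1 hi
  · filter_upwards [ae_restrict_mem measurableSet_Ioc] with t ht
    have := Real.rpow_nonneg ht.1.le (b - 1)
    positivity

/-- The powers t^b cancel, leaving powers of log t - log δ times dt/t. The antiderivative `g` is
explicit and vanishes at t = δ. -/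
theorem lintegral_tailBound_Ioc {b : ℝ} (hb : 0 < b) (d : ℕ) {δ : ℝ} (hδ : 0 < δ) (hδ1 : δ < 1) :
    ∫⁻ t in Ioc δ 1, ENNReal.ofReal (b * t ^ (b - 1)) * ENNReal.ofReal (tailBound b d (δ / t))
      = ENNReal.ofReal (δ ^ b *
        ∑ k ∈ Finset.range d, (-(b * Real.log δ)) ^ (k + 1) / (k + 1).factorial) := by
  set f : ℝ → ℝ := fun t => δ ^ b *
    ∑ k ∈ Finset.range d, (b * (Real.log t - Real.log δ)) ^ k / k.factorial * (b * t⁻¹) with hf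
  set g : ℝ → ℝ := fun t => δ ^ b *
    ∑ k ∈ Finset.range d, (b * (Real.log t - Real.log δ)) ^ (k + 1) / (k + 1).factorial with hg
  have h1 : ∀ t ∈ Ioc δ 1,
      ENNReal.ofReal (b * t ^ (b - 1)) * ENNReal.ofReal (tailBound b d (δ / t))
        = ENNReal.ofReal (f t) := by
    intro t ht
    have ht0 : 0 < t := hδ.trans ht.1
    rw [← ENNReal.ofReal_mul (by positivity), tailBound_of_lt_one _ _ ((div_lt_one ht0).2 ht.1),
      Real.log_div hδ.ne' ht0.ne', Real.div_rpow hδ.le ht0.le, Real.rpow_sub_one ht0.ne', hf]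
    congr 1
    have : t ^ b ≠ 0 := (Real.rpow_pos_of_pos ht0 b).ne'
    simp only [← Finset.sum_mul,
      show -(b * (Real.log δ - Real.log t)) = b * (Real.log t - Real.log δ) by ring]
    field_simp
  have hderiv : ∀ t ∈ uIcc δ 1, HasDerivAt g (f t) t := by
    intro t ht
    rw [uIcc_of_le hδ1.le] at ht
    have ht0 : t ≠ 0 := (hδ.trans_le ht.1).ne'
    refine HasDerivAt.const_mul _ (HasDerivAt.fun_sum fun k _ => ?_)
    have h := ((((Real.hasDerivAt_log ht0).sub_const (Real.log δ)).const_mul b).pow (k + 1)).div_const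
      ((k + 1).factorial : ℝ)
    refine h.congr_deriv ?_
    rw [Nat.factorial_succ]
    have : ((k.factorial : ℕ) : ℝ) ≠ 0 := by exact_mod_cast k.factorial_ne_zero
    push_cast
    field_simp
  have hcont : ContinuousOn f (uIcc δ 1) := by
    intro t ht
    rw [uIcc_of_le hδ1.le] at ht
    have ht0 : t ≠ 0 := (hδ.trans_le ht.1).ne'
    have : ContinuousAt f t := by
      simp only [hf]
      fun_prop (disch := assumption)
    exact this.continuousWithinAt
  have hi : IntervalIntegrable f volume δ 1 := hcont.intervalIntegrable
  rw [setLIntegral_congr_fun measurableSet_Ioc h1, ← ofReal_integral_eq_lintegral_ofReal,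
    ← intervalIntegral.integral_of_le hδ1.le,
    intervalIntegral.integral_eq_sub_of_hasDerivAt hderiv hi]
  · simp [hg]
  · exact (intervalIntegrable_iff_integrableOn_Ioc_of_le hδ1.le).1 hi
  · filter_upwards [ae_restrict_mem measurableSet_Ioc] with t ht
    have ht0 : 0 < t := hδ.trans ht.1
    have hl : 0 ≤ Real.log t - Real.log δ := sub_nonneg.2 (Real.log_le_log hδ ht.1.le)
    simp only [hf, Pi.zero_apply]
    positivity

/-- Conditioning on one coordinate t: for t ≤ δ the constraint on the others is void and the mass
δ^b is the term k = 0; for t > δ integration raises every index by one. -/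
theorem lintegral_tailBound {b : ℝ} (hb : 0 < b) (d : ℕ) {δ : ℝ} (hδ : 0 < δ) :
    ∫⁻ t in Ioc 0 1, ENNReal.ofReal (b * t ^ (b - 1)) * ENNReal.ofReal (tailBound b d (δ / t))
      = ENNReal.ofReal (tailBound b (d + 1) δ) := by
  have hone : ∀ t ∈ Ioc 0 δ,
      ENNReal.ofReal (b * t ^ (b - 1)) * ENNReal.ofReal (tailBound b d (δ / t))
        = ENNReal.ofReal (b * t ^ (b - 1)) := by
    intro t ht
    rw [tailBound_of_one_le _ _ ((one_le_div ht.1).2 ht.2)]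
    simp
  rcases le_or_gt 1 δ with h1 | h1
  · rw [setLIntegral_congr_fun measurableSet_Ioc fun t ht => hone t ⟨ht.1, ht.2.trans h1⟩,
      lintegral_rpow_Ioc hb zero_le_one, tailBound_of_one_le _ _ h1, Real.one_rpow]
  · rw [← Ioc_union_Ioc_eq_Ioc hδ.le h1.le,
      lintegral_union measurableSet_Ioc (Ioc_disjoint_Ioc_of_le le_rfl),
      setLIntegral_congr_fun measurableSet_Ioc hone, lintegral_rpow_Ioc hb hδ.le,
      lintegral_tailBound_Ioc hb d hδ h1, tailBound_of_lt_one _ _ h1, Finset.sum_range_succ',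
      ← ENNReal.ofReal_add]
    · congr 1
      simp
      ring
    · positivity
    · have : 0 ≤ -(b * Real.log δ) := by
        have := Real.log_nonpos hδ.le h1.le
        nlinarith
      positivity

/-- The uniform distribution on the unit cube. -/
def cubeMeasure (d : ℕ) : Measure (Fin d → ℝ) := Measure.pi fun _ => volume.restrict (Ioc 0 1)

theorem measurePreserving_cons_cube (d : ℕ) :
    MeasurePreserving (fun p : ℝ × (Fin d → ℝ) => (Fin.cons p.1 p.2 : Fin (d + 1) → ℝ))
      ((volume.restrict (Ioc 0 1)).prod (cubeMeasure d)) (cubeMeasure (d + 1)) := by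
  have h := (measurePreserving_piFinSuccAbove
    (fun _ : Fin (d + 1) => volume.restrict (Ioc (0 : ℝ) 1)) 0).symm
  have e : (fun p : ℝ × (Fin d → ℝ) => (Fin.cons p.1 p.2 : Fin (d + 1) → ℝ))
      = (MeasurableEquiv.piFinSuccAbove (fun _ => ℝ) 0).symm := by
    funext p
    exact (Fin.insertNth_zero' p.1 p.2).symm
  rw [e]
  exact h

theorem lintegral_cube_tail {b : ℝ} (hb : 0 < b) (d : ℕ) {δ : ℝ} (hδ : 0 < δ) :
    ∫⁻ t, {t : Fin d → ℝ | ∏ j, t j ≤ δ}.indicator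
        (fun t => ∏ j, ENNReal.ofReal (b * t j ^ (b - 1))) t ∂cubeMeasure d
      = ENNReal.ofReal (tailBound b d δ) := by
  induction d generalizing δ with
  | zero =>
    have : IsProbabilityMeasure (cubeMeasure 0) := by
      rw [cubeMeasure, Measure.pi_of_empty]
      infer_instance
    rcases le_or_gt 1 δ with h1 | h1
    · simp [indicator, tailBound, h1]
    · simp [indicator, tailBound, not_le.2 h1]
  | succ d ih =>
    have hmeas : ∀ (d : ℕ) (δ : ℝ), Measurable ({t : Fin d → ℝ | ∏ j, t j ≤ δ}.indicator
        fun t => ∏ j, ENNReal.ofReal (b * t j ^ (b - 1))) := by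
      intro d δ
      refine Measurable.indicator (by fun_prop) ?_
      exact measurableSet_le (by fun_prop) measurable_const
    have h := measurePreserving_cons_cube d
    have : SFinite (cubeMeasure d) := by
      unfold cubeMeasure
      infer_instance
    rw [← h.map_eq, lintegral_map (hmeas _ _) h.measurable,
      lintegral_prod (fun p : ℝ × (Fin d → ℝ) => {t : Fin (d + 1) → ℝ | ∏ j, t j ≤ δ}.indicator
        (fun t => ∏ j, ENNReal.ofReal (b * t j ^ (b - 1))) (Fin.cons p.1 p.2))
        ((hmeas _ _).comp h.measurable).aemeasurable, ← lintegral_tailBound hb d hδ]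
    refine setLIntegral_congr_fun measurableSet_Ioc fun t ht => ?_
    simp only
    rw [← ih (div_pos hδ ht.1), ← lintegral_const_mul _ (hmeas _ _)]
    refine lintegral_congr fun s => ?_
    simp only [indicator, mem_ofPred_eq, Fin.prod_univ_succ, Fin.cons_zero, Fin.cons_succ,
      le_div_iff₀' ht.1, mul_ite, mul_zero]

/-! ### The estimate of the kernel -/

theorem norm_kernel {d : ℕ} (N : ℕ) (z w : Fin d → S3) :
    ‖kernel N z w‖ = ∏ j, ((N + 1) * ‖herm (z j) (w j)‖ ^ N) := by
  have h : ‖(N + 1 : ℂ)‖ = N + 1 := by exact_mod_cast Complex.norm_natCast (N + 1)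
  simp only [kernel, kernelAux, norm_prod, norm_mul, norm_pow, h]

/-- With b = N/2+1 the exponent of t = |⟨z,w⟩|² is N/2 = b-1, and N+1 ≤ 2b costs a factor 2 per
sphere. This makes the bound 2^d times a probability density on the cube. -/
theorem enorm_kernel_le {d : ℕ} (N : ℕ) (z w : Fin d → S3) :
    ‖kernel N z w‖ₑ ≤ 2 ^ d * ∏ j, ENNReal.ofReal
      (((N : ℝ) / 2 + 1) * (‖herm (z j) (w j)‖ ^ 2) ^ ((N : ℝ) / 2 + 1 - 1)) := by
  have h2 : (2 : ℝ≥0∞) ^ d = ∏ _j : Fin d, ENNReal.ofReal 2 := by simp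
  rw [← ofReal_norm, norm_kernel, ENNReal.ofReal_prod_of_nonneg fun j _ => by positivity,
    h2, ← Finset.prod_mul_distrib]
  refine Finset.prod_le_prod' fun j _ => ?_
  rw [← ENNReal.ofReal_mul zero_le_two]
  refine ENNReal.ofReal_le_ofReal ?_
  rw [add_sub_cancel_right, ← Real.rpow_natCast _ 2, ← Real.rpow_mul (norm_nonneg _)]
  push_cast
  rw [mul_div_cancel₀ _ two_ne_zero, Real.rpow_natCast, ← mul_assoc]
  refine mul_le_mul_of_nonneg_right ?_ (by positivity)
  linarith

/-- The constant of the estimate. -/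
def decay (d N : ℕ) (D : ℝ) : ℝ :=
  4 / Real.sqrt (2 * Real.pi * d) * 4 ^ d * Real.exp (-((N + 1) * D ^ 2 / 16))

theorem decay_nonneg (d N : ℕ) (D : ℝ) : 0 ≤ decay d N D := by
  unfold decay
  positivity

theorem two_pow_mul_tailBound_le {d : ℕ} (hd : 1 ≤ d) (N : ℕ) {D : ℝ} (hD : 0 < D) :
    2 ^ d * tailBound ((N : ℝ) / 2 + 1) d (Real.exp (-(D ^ 2 / 4))) ≤ decay d N D := by
  -- This is x = -b log δ, so δ^b = exp(-x). One factor exp(-x/2) tames the Poisson sum and the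
  -- other is kept; replacing N+2 by N+1 is the last, harmless loss.
  set x : ℝ := (N + 2) * D ^ 2 / 8 with hx
  have hx0 : 0 ≤ x := by positivity
  have h1 : Real.exp (-(D ^ 2 / 4)) < 1 := Real.exp_lt_one_iff.2 (by linarith [pow_pos hD 2])
  have e1 : Real.exp (-(D ^ 2 / 4)) ^ ((N : ℝ) / 2 + 1)
      = Real.exp (-(x / 2)) * Real.exp (-(x / 2)) := by
    rw [← Real.exp_mul, ← Real.exp_add]
    congr 1
    rw [hx]
    ring
  have e2 : -(((N : ℝ) / 2 + 1) * -(D ^ 2 / 4)) = x := by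
    rw [hx]
    ring
  rw [tailBound_of_lt_one _ _ h1, Real.log_exp, e1, e2]
  have h2 := sum_pow_div_factorial_mul_exp_le hx0 hd
  calc _ = 2 ^ d * Real.exp (-(x / 2)) *
        ((∑ k ∈ Finset.range d, x ^ k / k.factorial) * Real.exp (-(x / 2))) := by ring
    _ ≤ 2 ^ d * Real.exp (-(x / 2)) * (4 / Real.sqrt (2 * Real.pi * d) * 2 ^ d) :=
        mul_le_mul_of_nonneg_left h2 (by positivity)
    _ = 4 / Real.sqrt (2 * Real.pi * d) * 4 ^ d * Real.exp (-(x / 2)) := by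
        rw [show (4 : ℝ) ^ d = 2 ^ d * 2 ^ d by rw [← mul_pow]; norm_num]
        ring
    _ ≤ decay d N D := by
        refine mul_le_mul_of_nonneg_left (Real.exp_le_exp.2 ?_) (by positivity)
        rw [hx]
        nlinarith [pow_pos hD 2]

/-- The geometry of V enters only through the inclusion of its preimage in {∏ t_j ≤ δ}; integrating
over this larger set gives a bound independent of z. -/
theorem setLIntegral_kernel_le {d : ℕ} (hd : 1 ≤ d) (N : ℕ) {D : ℝ} (hD : 0 < D)
    {V : Set (Fin d → S2)} (z : Fin d → S3)
    (hV : ∀ y ∈ V, D ≤ prodDist (proj z) y) :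
    ∫⁻ w in proj ⁻¹' V, ‖kernel N z w‖ₑ ∂bundleMeasure d ≤ ENNReal.ofReal (decay d N D) := by
  set b : ℝ := (N : ℝ) / 2 + 1
  have hb : 0 < b := by positivity
  set δ := Real.exp (-(D ^ 2 / 4))
  set g : (Fin d → ℝ) → ℝ≥0∞ := {t : Fin d → ℝ | ∏ j, t j ≤ δ}.indicator
        (fun t => ∏ j, ENNReal.ofReal (b * t j ^ (b - 1))) with hg
  have hgm : Measurable g := by
    refine Measurable.indicator (by fun_prop) ?_
    exact measurableSet_le (by fun_prop) measurable_const
  have hmp : MeasurePreserving (fun (w : Fin d → S3) j => ‖herm (z j) (w j)‖ ^ 2)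
      (bundleMeasure d) (cubeMeasure d) :=
    measurePreserving_pi (fun _ => sigma) (fun _ => volume.restrict (Ioc 0 1))
      fun j => measurePreserving_norm_sq_herm (z j)
  calc ∫⁻ w in proj ⁻¹' V, ‖kernel N z w‖ₑ ∂bundleMeasure d
      ≤ ∫⁻ w in proj ⁻¹' V, 2 ^ d * g (fun j => ‖herm (z j) (w j)‖ ^ 2) ∂bundleMeasure d := by
        refine setLIntegral_mono (measurable_const.mul (hgm.comp hmp.measurable)) fun w hw => ?_
        have h1 := prod_norm_sq_herm_le hD.le (hV _ hw)
        rw [hg, indicator_of_mem (s := {t : Fin d → ℝ | ∏ j, t j ≤ δ}) h1]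
        exact enorm_kernel_le N z w
    _ ≤ ∫⁻ w, 2 ^ d * g (fun j => ‖herm (z j) (w j)‖ ^ 2) ∂bundleMeasure d :=
        setLIntegral_le_lintegral _ _
    _ = 2 ^ d * ENNReal.ofReal (tailBound b d δ) := by
        rw [lintegral_const_mul (f := fun w : Fin d → S3 => g fun j => ‖herm (z j) (w j)‖ ^ 2) _
          (hgm.comp hmp.measurable), hmp.lintegral_comp hgm, hg,
          lintegral_cube_tail hb d (Real.exp_pos _)]
    _ = ENNReal.ofReal (2 ^ d * tailBound b d δ) := by
        rw [ENNReal.ofReal_mul (by positivity)]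
        simp
    _ ≤ _ := ENNReal.ofReal_le_ofReal (two_pow_mul_tailBound_le hd N hD)

/-! ### Schur's test -/

section Schur

variable {X : Type*} [MeasurableSpace X] {μ : Measure X} {k : X → X → ℝ≥0∞} {u : X → ℝ≥0∞}
  {A B : Set X} {M : ℝ≥0∞}

theorem setLIntegral_kernel_mul_le [SFinite μ] (hk : Measurable (Function.uncurry k))
    (hu : Measurable u)
    (hcol : ∀ w ∈ B, ∫⁻ z in A, k z w ∂μ ≤ M) :
    ∫⁻ z in A, ∫⁻ w in B, k z w * u w ∂μ ∂μ ≤ M * ∫⁻ w, u w ∂μ := by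
  have hm : Measurable (Function.uncurry fun z w => k z w * u w) :=
    hk.mul (hu.comp measurable_snd)
  rw [lintegral_lintegral_swap hm.aemeasurable]
  calc ∫⁻ w in B, ∫⁻ z in A, k z w * u w ∂μ ∂μ ≤ ∫⁻ w in B, M * u w ∂μ := by
        refine setLIntegral_mono (by fun_prop) fun w hw => ?_
        rw [lintegral_mul_const _ hk.of_uncurry_right]
        exact mul_le_mul_left (hcol w hw) _
    _ ≤ ∫⁻ w, M * u w ∂μ := setLIntegral_le_lintegral _ _
    _ = M * ∫⁻ w, u w ∂μ := lintegral_const_mul _ hu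

/-- Cauchy–Schwarz for the splitting f g = f^(1/2) · (f^(1/2) g). -/
theorem lintegral_mul_sq_le {f g : X → ℝ≥0∞} (hf : Measurable f) (hg : Measurable g) :
    (∫⁻ x, f x * g x ∂μ) ^ 2 ≤ (∫⁻ x, f x ∂μ) * ∫⁻ x, f x * g x ^ 2 ∂μ := by
  have hsq : ∀ x : ℝ≥0∞, (x ^ (1 / 2 : ℝ)) ^ 2 = x := by
    intro x
    rw [← ENNReal.rpow_natCast, ← ENNReal.rpow_mul]
    norm_num
  have h := ENNReal.lintegral_mul_norm_pow_le (μ := μ) (f := f) (g := fun x => f x * g x ^ 2)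
    (p := 1 / 2) (q := 1 / 2) hf.aemeasurable (by fun_prop) (by norm_num) (by norm_num)
    (by norm_num)
  have e : ∀ x, f x ^ (1 / 2 : ℝ) * (f x * g x ^ 2) ^ (1 / 2 : ℝ) = f x * g x := by
    intro x
    rw [ENNReal.mul_rpow_of_nonneg _ _ (by norm_num), ← mul_assoc, ← sq, hsq,
      ← ENNReal.rpow_natCast, ← ENNReal.rpow_mul]
    norm_num
  simp only [e] at h
  calc _ ≤ ((∫⁻ x, f x ∂μ) ^ (1 / 2 : ℝ) * (∫⁻ x, f x * g x ^ 2 ∂μ) ^ (1 / 2 : ℝ)) ^ 2 :=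
        pow_le_pow_left' h 2
    _ = _ := by rw [mul_pow, hsq, hsq]

/-- One factor M comes from the rows, by Cauchy–Schwarz with weight k(z,·), and the other from the
columns, after exchanging the integrals. -/
theorem setLIntegral_kernel_mul_sq_le [SFinite μ] (hk : Measurable (Function.uncurry k))
    (hu : Measurable u)
    (hrow : ∀ z ∈ A, ∫⁻ w in B, k z w ∂μ ≤ M) (hcol : ∀ w ∈ B, ∫⁻ z in A, k z w ∂μ ≤ M) :
    ∫⁻ z in A, (∫⁻ w in B, k z w * u w ∂μ) ^ 2 ∂μ ≤ M ^ 2 * ∫⁻ w, u w ^ 2 ∂μ := by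
  have hm : Measurable fun z => ∫⁻ w in B, k z w * u w ^ 2 ∂μ :=
    Measurable.lintegral_prod_right' (f := fun p : X × X => k p.1 p.2 * u p.2 ^ 2)
      (hk.mul ((hu.comp measurable_snd).pow_const 2))
  calc ∫⁻ z in A, (∫⁻ w in B, k z w * u w ∂μ) ^ 2 ∂μ
      ≤ ∫⁻ z in A, M * ∫⁻ w in B, k z w * u w ^ 2 ∂μ ∂μ := by
        refine setLIntegral_mono (hm.const_mul M) fun z hz => ?_
        refine (lintegral_mul_sq_le hk.of_uncurry_left hu).trans ?_
        exact mul_le_mul_left (hrow z hz) _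
    _ = M * ∫⁻ z in A, ∫⁻ w in B, k z w * u w ^ 2 ∂μ ∂μ := lintegral_const_mul _ hm
    _ ≤ M * (M * ∫⁻ w, u w ^ 2 ∂μ) :=
        mul_le_mul_right (setLIntegral_kernel_mul_le hk (hu.pow_const 2) hcol) _
    _ = _ := by rw [← mul_assoc, sq]

end Schur

/-! ### The localised Szegő projector -/

theorem localizedSzego_ae {d : ℕ} (N : ℕ) {U V : Set (Fin d → S2)} (hU : MeasurableSet U)
    (hV : MeasurableSet V) (f : L2Sections d N) :
    (localizedSzego N hU hV f : Lp ℂ 2 (bundleMeasure d)) =ᵐ[bundleMeasure d]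
      (proj ⁻¹' U).indicator fun z => ∫ w in proj ⁻¹' V, kernel N z w *
        (f : Lp ℂ 2 (bundleMeasure d)) w ∂bundleMeasure d := by
  have h1 := cutoffFun_ae hU (szego d N (cutoffFun hV f))
  have h2 := (isSzegoKernel_kernel d N).represents (cutoffFun hV f)
  have h3 := cutoffFun_ae hV f
  filter_upwards [h1, h2] with z a b
  refine a.trans ?_
  by_cases hz : z ∈ proj ⁻¹' U
  · rw [indicator_of_mem hz, indicator_of_mem hz, b, ← integral_indicator (measurable_proj hV)]
    refine integral_congr_ae (h3.mono fun w hw => ?_)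
    simp only [hw]
    by_cases hw' : w ∈ proj ⁻¹' V
    · simp only [indicator_of_mem hw']
    · simp only [indicator_of_notMem hw', mul_zero]
  · rw [indicator_of_notMem hz, indicator_of_notMem hz]

theorem enorm_localizedSzego_le {d : ℕ} (N : ℕ) {U V : Set (Fin d → S2)} (hU : MeasurableSet U)
    (hV : MeasurableSet V) (f : L2Sections d N) :
    ∀ᵐ z ∂bundleMeasure d, ‖(localizedSzego N hU hV f : Lp ℂ 2 (bundleMeasure d)) z‖ₑ ≤
      (proj ⁻¹' U).indicator (fun z => ∫⁻ w in proj ⁻¹' V, ‖kernel N z w‖ₑ *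
        ‖(f : Lp ℂ 2 (bundleMeasure d)) w‖ₑ ∂bundleMeasure d) z := by
  filter_upwards [localizedSzego_ae N hU hV f] with z hz
  rw [hz]
  by_cases h : z ∈ proj ⁻¹' U
  · rw [indicator_of_mem h, indicator_of_mem h]
    refine (enorm_integral_le_lintegral_enorm _).trans (le_of_eq ?_)
    simp only [enorm_mul]
  · rw [indicator_of_notMem h, indicator_of_notMem h, enorm_zero]

section Bounds

variable {d N : ℕ} {U V : Set (Fin d → S2)} {C : ℝ}

theorem measurable_enorm_kernel (d N : ℕ) :
    Measurable (Function.uncurry fun z w : Fin d → S3 => ‖kernel N z w‖ₑ) :=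
  (continuous_kernel N).measurable.enorm

theorem measurable_enorm_L2Sections (f : L2Sections d N) :
    Measurable fun w => ‖(f : Lp ℂ 2 (bundleMeasure d)) w‖ₑ :=
  (Lp.stronglyMeasurable (f : Lp ℂ 2 (bundleMeasure d))).measurable.enorm

theorem lpBound_top_of_row (hU : MeasurableSet U) (hV : MeasurableSet V)
    (hrow : ∀ z ∈ proj ⁻¹' U,
      ∫⁻ w in proj ⁻¹' V, ‖kernel N z w‖ₑ ∂bundleMeasure d ≤ ENNReal.ofReal C) :
    LpBound ⊤ (localizedSzego N hU hV) C := by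
  intro f
  rw [eLpNorm_exponent_top, eLpNorm_exponent_top]
  refine eLpNormEssSup_le_of_ae_enorm_bound ?_
  filter_upwards [enorm_localizedSzego_le N hU hV f] with z hz
  refine hz.trans ?_
  by_cases h : z ∈ proj ⁻¹' U
  · rw [indicator_of_mem h]
    set S := eLpNormEssSup (f : Lp ℂ 2 (bundleMeasure d)) (bundleMeasure d)
    have hm : Measurable fun w : Fin d → S3 => ‖kernel N z w‖ₑ :=
      (measurable_enorm_kernel d N).of_uncurry_left
    calc _ ≤ ∫⁻ w in proj ⁻¹' V, ‖kernel N z w‖ₑ * S ∂bundleMeasure d := by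
          refine lintegral_mono_ae (ae_restrict_of_ae ?_)
          filter_upwards [enorm_ae_le_eLpNormEssSup (f : Lp ℂ 2 (bundleMeasure d))
            (bundleMeasure d)] with w hw
          exact mul_le_mul_right hw _
      _ ≤ ENNReal.ofReal C * S := by
          rw [lintegral_mul_const _ hm]
          exact mul_le_mul_left (hrow z h) _
  · rw [indicator_of_notMem h]
    exact zero_le

theorem lpBound_one_of_col (hU : MeasurableSet U) (hV : MeasurableSet V)
    (hcol : ∀ w ∈ proj ⁻¹' V,
      ∫⁻ z in proj ⁻¹' U, ‖kernel N z w‖ₑ ∂bundleMeasure d ≤ ENNReal.ofReal C) :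
    LpBound 1 (localizedSzego N hU hV) C := by
  intro f
  rw [eLpNorm_one_eq_lintegral_enorm, eLpNorm_one_eq_lintegral_enorm]
  refine (lintegral_mono_ae (enorm_localizedSzego_le N hU hV f)).trans ?_
  rw [lintegral_indicator (measurable_proj hU)]
  exact setLIntegral_kernel_mul_le (measurable_enorm_kernel d N) (measurable_enorm_L2Sections f)
    hcol

theorem norm_localizedSzego_le (hC : 0 ≤ C) (hU : MeasurableSet U) (hV : MeasurableSet V)
    (hrow : ∀ z ∈ proj ⁻¹' U,
      ∫⁻ w in proj ⁻¹' V, ‖kernel N z w‖ₑ ∂bundleMeasure d ≤ ENNReal.ofReal C)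
    (hcol : ∀ w ∈ proj ⁻¹' V,
      ∫⁻ z in proj ⁻¹' U, ‖kernel N z w‖ₑ ∂bundleMeasure d ≤ ENNReal.ofReal C) :
    ‖localizedSzego N hU hV‖ ≤ C := by
  refine ContinuousLinearMap.opNorm_le_bound _ hC fun f => ?_
  have hsq : ∀ g : (Fin d → S3) → ℂ, eLpNorm g 2 (bundleMeasure d) ^ 2
      = ∫⁻ z, ‖g z‖ₑ ^ 2 ∂bundleMeasure d := by
    intro g
    have h := eLpNorm_nnreal_pow_eq_lintegral (μ := bundleMeasure d) (f := g) (p := 2) two_ne_zero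
    simpa using h
  have h : eLpNorm (localizedSzego N hU hV f : Lp ℂ 2 (bundleMeasure d)) 2 (bundleMeasure d) ≤
      ENNReal.ofReal C * eLpNorm (f : Lp ℂ 2 (bundleMeasure d)) 2 (bundleMeasure d) := by
    rw [← ENNReal.pow_le_pow_left_iff two_ne_zero, mul_pow, hsq, hsq]
    calc _ ≤ ∫⁻ z, (proj ⁻¹' U).indicator (fun z => (∫⁻ w in proj ⁻¹' V, ‖kernel N z w‖ₑ *
          ‖(f : Lp ℂ 2 (bundleMeasure d)) w‖ₑ ∂bundleMeasure d) ^ 2) z ∂bundleMeasure d := by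
          refine lintegral_mono_ae ?_
          filter_upwards [enorm_localizedSzego_le N hU hV f] with z hz
          refine (pow_le_pow_left' hz 2).trans (le_of_eq ?_)
          by_cases hzU : z ∈ proj ⁻¹' U
          · rw [indicator_of_mem hzU, indicator_of_mem hzU]
          · rw [indicator_of_notMem hzU, indicator_of_notMem hzU, zero_pow two_ne_zero]
      _ ≤ _ := by
          rw [lintegral_indicator (measurable_proj hU)]
          exact setLIntegral_kernel_mul_sq_le (measurable_enorm_kernel d N)
            (measurable_enorm_L2Sections f) hrow hcol
  rw [Submodule.coe_norm, Submodule.coe_norm, Lp.norm_def, Lp.norm_def]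
  calc _ ≤ (ENNReal.ofReal C *
        eLpNorm (f : Lp ℂ 2 (bundleMeasure d)) 2 (bundleMeasure d)).toReal :=
        ENNReal.toReal_mono (ENNReal.mul_ne_top ENNReal.ofReal_ne_top (Lp.eLpNorm_ne_top _)) h
    _ = _ := by rw [ENNReal.toReal_mul, ENNReal.toReal_ofReal hC]

end Bounds

theorem prodDist_comm {d : ℕ} (x y : Fin d → S2) : prodDist x y = prodDist y x := by
  simp only [prodDist, sphereDist, InnerProductGeometry.angle_comm]

section AtDistance

variable {d : ℕ} {U V : Set (Fin d → S2)} {D : ℝ}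

theorem AtDistance.row (hd : 1 ≤ d) (N : ℕ) (hD : 0 < D) (h : AtDistance U V D) :
    ∀ z ∈ proj ⁻¹' U,
      ∫⁻ w in proj ⁻¹' V, ‖kernel N z w‖ₑ ∂bundleMeasure d ≤ ENNReal.ofReal (decay d N D) :=
  fun z hz => setLIntegral_kernel_le hd N hD z fun _ hy => h.1 (mem_image2_of_mem hz hy)

theorem AtDistance.col (hd : 1 ≤ d) (N : ℕ) (hD : 0 < D) (h : AtDistance U V D) :
    ∀ w ∈ proj ⁻¹' V,
      ∫⁻ z in proj ⁻¹' U, ‖kernel N z w‖ₑ ∂bundleMeasure d ≤ ENNReal.ofReal (decay d N D) := by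
  intro w hw
  have e : ∀ z : Fin d → S3, ‖kernel N z w‖ₑ = ‖kernel N w z‖ₑ := fun z => by
    rw [← conj_kernel N w z, RCLike.enorm_conj]
  simp only [e]
  refine setLIntegral_kernel_le hd N hD w fun y hy => ?_
  rw [prodDist_comm]
  exact h.1 (mem_image2_of_mem hy hw)

theorem AtDistance.norm_localizedSzego_le (hd : 1 ≤ d) (N : ℕ) (hD : 0 < D) (h : AtDistance U V D)
    (hU : MeasurableSet U) (hV : MeasurableSet V) :
    ‖localizedSzego N hU hV‖ ≤ decay d N D :=
  SzegoSpheres.norm_localizedSzego_le (decay_nonneg d N D) hU hV (h.row hd N hD) (h.col hd N hD)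

end AtDistance

/-- For d ≥ 3 one has 2πd ≥ 16, so the prefactor is at most 1. The constant 125/84 = 100(1/16 -
1/21) is the rate available to absorb 4^d when (N+1)D² ≥ 100d, and it exceeds log 4. -/
theorem decay_le_exp {d : ℕ} (hd : 3 ≤ d) (N : ℕ) {D : ℝ}
    (hD : 10 * Real.sqrt (d / (N + 1)) ≤ D) :
    decay d N D ≤ Real.exp (-(1 / 21 * (N + 1) * D ^ 2)) := by
  have hd' : (3 : ℝ) ≤ d := by exact_mod_cast hd
  have hN : (0 : ℝ) < N + 1 := by positivity
  have h1 : 100 * (d : ℝ) ≤ (N + 1) * D ^ 2 := by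
    have h := pow_le_pow_left₀ (by positivity) hD 2
    rw [mul_pow, Real.sq_sqrt (by positivity), ← mul_div_assoc, div_le_iff₀ hN] at h
    linarith
  have h2 : 4 / Real.sqrt (2 * Real.pi * d) ≤ 1 := by
    rw [div_le_one (Real.sqrt_pos.2 (by positivity)), Real.le_sqrt' (by norm_num)]
    nlinarith [Real.pi_gt_three]
  have h3 : (4 : ℝ) ^ d ≤ Real.exp (d * (125 / 84)) := by
    rw [Real.exp_nat_mul]
    refine pow_le_pow_left₀ (by norm_num) ?_ d
    rw [← Real.log_le_iff_le_exp (by norm_num), show (4 : ℝ) = 2 ^ 2 by norm_num, Real.log_pow]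
    push_cast
    linarith [Real.log_two_lt_d9]
  calc decay d N D ≤ 1 * Real.exp (d * (125 / 84)) * Real.exp (-((N + 1) * D ^ 2 / 16)) := by
        unfold decay
        gcongr
    _ = Real.exp (d * (125 / 84) - (N + 1) * D ^ 2 / 16) := by
        rw [one_mul, ← Real.exp_add, sub_eq_add_neg]
    _ ≤ _ := Real.exp_le_exp.2 (by linarith)

end SzegoSpheres

end

theorem proposition2p4 (d N : ℕ) (hd : 1 ≤ d) :
    (∃ K : (Fin d → SzegoSpheres.S3) → (Fin d → SzegoSpheres.S3) → ℂ,
      SzegoSpheres.IsSzegoKernel d N K ∧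
      ∀ (U V : Set (Fin d → SzegoSpheres.S2)) (hU : MeasurableSet U) (hV : MeasurableSet V)
        (D : ℝ), 0 < D → SzegoSpheres.AtDistance U V D →
        (∀ z : Fin d → SzegoSpheres.S3, SzegoSpheres.proj z ∈ U →
          ∫⁻ w in SzegoSpheres.proj ⁻¹' V, ‖K z w‖ₑ ∂SzegoSpheres.bundleMeasure d ≤
            ENNReal.ofReal (4 / Real.sqrt (2 * Real.pi * d) * 4 ^ d *
              Real.exp (-((N + 1) * D ^ 2 / 16)))) ∧
        SzegoSpheres.LpBound ⊤ (SzegoSpheres.localizedSzego N hU hV)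
          (4 / Real.sqrt (2 * Real.pi * d) * 4 ^ d * Real.exp (-((N + 1) * D ^ 2 / 16))) ∧
        SzegoSpheres.LpBound 1 (SzegoSpheres.localizedSzego N hU hV)
          (4 / Real.sqrt (2 * Real.pi * d) * 4 ^ d * Real.exp (-((N + 1) * D ^ 2 / 16))) ∧
        ‖SzegoSpheres.localizedSzego N hU hV‖ ≤
          4 / Real.sqrt (2 * Real.pi * d) * 4 ^ d * Real.exp (-((N + 1) * D ^ 2 / 16))) ∧
    (3 ≤ d →
      ∀ (U V : Set (Fin d → SzegoSpheres.S2)) (hU : MeasurableSet U) (hV : MeasurableSet V)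
        (D : ℝ), 10 * Real.sqrt (d / (N + 1)) ≤ D → SzegoSpheres.AtDistance U V D →
        ‖SzegoSpheres.localizedSzego N hU hV‖ ≤ Real.exp (-(1 / 21 * (N + 1) * D ^ 2))) := by
  refine ⟨⟨SzegoSpheres.kernel N, SzegoSpheres.isSzegoKernel_kernel d N,
    fun U V hU hV D hD h => ⟨h.row hd N hD, ?_, ?_, h.norm_localizedSzego_le hd N hD hU hV⟩⟩,
    fun hd3 U V hU hV D hD h => ?_⟩
  · exact SzegoSpheres.lpBound_top_of_row hU hV (h.row hd N hD)
  · exact SzegoSpheres.lpBound_one_of_col hU hV (h.col hd N hD)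
  · have hpos : 0 < D := lt_of_lt_of_le (by positivity) hD
    exact (h.norm_localizedSzego_le hd N hpos hU hV).trans (SzegoSpheres.decay_le_exp hd3 N hD)
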